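/- Let $S\subset\mathbb R^3$ be an irreducible real algebraic surface, i.e. the real zero set of an irreducible polynomial $F\in\mathbb R[x,y,z]$ such that every polynomial vanishing on $S$ is a multiple of $F$ (so that $S$ is really two-dimensional). Assume that $S$ is not a plane and that it is a surface of revolution with axis of revolution $\ell$: $\ell$ is a line and $S$ is invariant under every rotation about $\ell$. Let $\Pi$ be any plane containing $\ell$ and let $\mathcal D=S\cap\Pi$ be the corresponding directrix curve. A symmetry axis of $S$ is a line such that $S$ is invariant under the half-turn about it; a symmetry plane of $S$ is a plane such that $S$ is invariant under the reflection in it; a symmetry axis of $\mathcal D$ is a line of $\Pi$ such that $\mathcal D$ is invariant under the reflection of $\Pi$ in it. Then: (a) $S$ is centrally symmetric with respect to some point if and only if $\mathcal D$ is centrally symmetric with respect to some point of $\ell$. Suppose moreover that $S$ is not a sphere. Then: (b) A line $\tilde\ell\neq\ell$ is a symmetry axis of $S$ if and only if $\tilde\ell$ is the image, under some rotation about $\ell$, of a symmetry axis of $\mathcal D$ that is perpendicular to $\ell$. (c) A plane $Q$ not containing $\ell$ is a symmetry plane of $S$ if and only if $Q$ is perpendicular to $\ell$ and the line $Q\cap\Pi$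 is a symmetry axis of $\mathcal D$. (d) If $\mathcal D$ has no symmetry axis perpendicular to $\ell$, then $\ell$ is the only symmetry axis of $S$, and the symmetry planes of $S$ are exactly the planes containing $\ell$. (e) Either $\ell$ is the only symmetry axis of $S$, or $S$ has infinitely many symmetry axes. (f) $S$ has infinitely many symmetry axes if and only if $S$ has a symmetry plane not containing $\ell$. Furthermore, the symmetry axes of $S$ are exactly $\ell$ and the lines $R\cap Q$, where $R$ is a plane containing $\ell$ and $Q$ is a symmetry plane of $S$ not containing $\ell$. (g) If $S$ has infinitely many symmetry axes and is not cylindrical (i.e. $S$ is not a union of lines parallel to one fixed direction), then all symmetry axes of $S$ other than $\ell$ lie in one plane, which is a symmetry plane of $S$. -/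

import Mathlib

/-- Euclidean three-space `ℝ³` with its Euclidean distance. -/
abbrev E3 : Type := EuclideanSpace ℝ (Fin 3)

/-- An irreducible real algebraic surface in `ℝ³`: the real zero set of an irreducible polynomial
`F ∈ ℝ[x, y, z]`, where every polynomial that vanishes on the surface is a multiple of `F`.
The last clause says that the real zero set is really two-dimensional; it discards such zero sets
as the line `x² + y² = 0`, the point `x² + y² + z² = 0` and the empty set `x² + 1 = 0`. -/
def IsIrreducibleAlgebraicSurface (S : Set E3) : Prop :=
  ∃ F : MvPolynomial (Fin 3) ℝ, Irreducible F ∧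
    S = {p : E3 | MvPolynomial.eval (fun i => p i) F = 0} ∧
    ∀ G : MvPolynomial (Fin 3) ℝ, (∀ p ∈ S, MvPolynomial.eval (fun i => p i) G = 0) → F ∣ G

/-- A line of `ℝ³`: a nonempty affine subspace of dimension one. -/
def IsLine (m : AffineSubspace ℝ E3) : Prop :=
  (m : Set E3).Nonempty ∧ Module.finrank ℝ m.direction = 1

/-- A plane of `ℝ³`: a nonempty affine subspace of dimension two. -/
def IsPlane (P : AffineSubspace ℝ E3) : Prop :=
  (P : Set E3).Nonempty ∧ Module.finrank ℝ P.direction = 2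

/-- The affine subspaces `A` and `B` are normal (perpendicular): every direction of `A` is
orthogonal to every direction of `B`. It is used for two lines, and for a plane and a line. -/
def IsNormalTo (A B : AffineSubspace ℝ E3) : Prop :=
  A.direction ⟂ B.direction

/-- The point set `X` is a sphere (of positive radius). -/
def IsSphereSet (X : Set E3) : Prop :=
  ∃ (c : E3) (r : ℝ), 0 < r ∧ X = Metric.sphere c r

/-- The point set `X` is a plane. -/
def IsPlaneSet (X : Set E3) : Prop :=
  ∃ P : AffineSubspace ℝ E3, IsPlane P ∧ X = (P : Set E3)

/-- `X` is cylindrical: it is a union of lines, all parallel to one direction `v`. -/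
def IsCylindrical (X : Set E3) : Prop :=
  ∃ v : E3, v ≠ 0 ∧ ∀ p ∈ X, ∀ t : ℝ, p + t • v ∈ X

/-- `g` is a rotation about the line `m` (by some angle, possibly zero): a direct isometry of `ℝ³`
that fixes every point of `m`. -/
def IsRotationAbout (m : AffineSubspace ℝ E3) (g : E3 ≃ᵃⁱ[ℝ] E3) : Prop :=
  (∀ p ∈ m, g p = p) ∧
    LinearMap.det (g.linearIsometryEquiv.toLinearEquiv : E3 →ₗ[ℝ] E3) = 1

/-- The line `m` is an axis of revolution of `S`: every rotation about `m` leaves `S` invariant. -/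
def IsAxisOfRevolution (m : AffineSubspace ℝ E3) (S : Set E3) : Prop :=
  IsLine m ∧ ∀ g : E3 ≃ᵃⁱ[ℝ] E3, IsRotationAbout m g → g '' S = S

/-- `X` is invariant under the reflection in the nonempty affine subspace `A`, i.e. under the map
`p ↦ 2 π(p) - p` where `π` is the orthogonal projection onto `A`. For a plane `A` this map is the
mirror symmetry in `A`; for a line `A` it is the half-turn (rotation by the angle `π`) about `A`,
and it restricts, on every plane through `A`, to the mirror symmetry of that plane in `A`. -/
def IsSymmetricAbout (A : AffineSubspace ℝ E3) (X : Set E3) : Prop :=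
  ∃ _ : Nonempty A, EuclideanGeometry.reflection A '' X = X

/-- The point `c` is a symmetry center of `X`: the central inversion `p ↦ 2 c - p` leaves `X`
invariant. -/
def IsSymmetryCenter (c : E3) (X : Set E3) : Prop :=
  Equiv.pointReflection c '' X = X

/-- The line `m` is a symmetry axis of `S`: the half-turn about `m` leaves `S` invariant. -/
def IsSymmetryAxis (m : AffineSubspace ℝ E3) (S : Set E3) : Prop :=
  IsLine m ∧ IsSymmetricAbout m S

/-- The plane `P` is a symmetry plane of `S`: the mirror symmetry in `P` leaves `S` invariant. -/
def IsSymmetryPlane (P : AffineSubspace ℝ E3) (S : Set E3) : Prop :=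
  IsPlane P ∧ IsSymmetricAbout P S

/-- The line `m` is a symmetry axis of the planar curve `D`, which lies in the plane `P`: `m` is a
line of the plane `P`, and the mirror symmetry of `P` in `m` leaves `D` invariant. -/
def IsPlanarSymmetryAxis (P m : AffineSubspace ℝ E3) (D : Set E3) : Prop :=
  IsLine m ∧ m ≤ P ∧ IsSymmetricAbout m D

/-- The directrix curve cut out of `S` by the plane `P` through the axis of revolution. -/
def directrix (S : Set E3) (P : AffineSubspace ℝ E3) : Set E3 :=
  S ∩ (P : Set E3)

/-! The theorem rests on one fact, `IsEquationOf.eq_or_isSphereSet_of_two_axes`: a surface that is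
neither a plane nor a sphere has only one axis of revolution. A symmetry of `S` carries an axis of
revolution to an axis of revolution, so it preserves `ℓ`. Hence a mirror plane or half-turn axis
meets `ℓ` and is parallel or perpendicular to it
(`IsRevolutionSurface.exists_mem_of_isSymmetricAbout`). A symmetry center lies on `ℓ`, even for a
sphere, because parallel axes of revolution always coincide.

Membership in `S` depends only on the height along `ℓ` and the distance from a point `o` of `ℓ`. The
point reflection in `o`, the mirror in the plane normal to `ℓ` at `o` and the half-turn about any
normal line through `o` all negate the height and keep the distance. Invariance of `S` under any of
them, or of the directrix under the planar ones, is therefore one condition, `RevSymmetric o u S`.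
What remains is linear geometry. In the last claim, two such points `o` would give a translation and
make `S` cylindrical.

Uniqueness of the axis is proved infinitesimally. An axis through `b` with direction `v` makes the
rotation field `p ↦ v × (p - b)` tangent to `S`. For skew axes, combinations of such fields are
constant along each axis, and two independent translations force a plane. For distinct parallel
axes, the difference of the fields is constant, and a right-angle turn about an axis gives a second
translation. For concurrent axes, all rotation fields around the common point are tangent, so `S` is
a union of concentric spheres. Tangency becomes invariance in `IsEquationOf.mem_of_integralCurve`,
and a union of level sets becomes a single one in `IsEquationOf.exists_level`. -/

/-! ### Polynomial vector fields tangent to a surface, and unions of level sets. -/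

open MvPolynomial in
/-- Chain rule for a polynomial in three variables along a differentiable curve. -/
theorem hasDerivAt_eval_comp (F : MvPolynomial (Fin 3) ℝ) (γ : ℝ → E3) (γ' : Fin 3 → ℝ) (t : ℝ)
    (h : ∀ i, HasDerivAt (fun s => γ s i) (γ' i) t) :
    HasDerivAt (fun s => eval (fun i => γ s i) F)
      (∑ i, γ' i * eval (fun i => γ t i) (pderiv i F)) t := by
  induction F using MvPolynomial.induction_on with
  | C a => simpa using hasDerivAt_const t a
  | add p q hp hq =>
    simp only [map_add, mul_add, Finset.sum_add_distrib]
    exact hp.add hq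
  | mul_X p j hp =>
    have := hp.mul (h j)
    simp only [map_mul, eval_X]
    refine this.congr_deriv ?_
    simp only [Derivation.leibniz, pderiv_X, smul_eq_mul, map_add, map_mul, eval_X, mul_add,
      Finset.sum_add_distrib, Pi.single_apply, Finset.sum_mul]
    rw [add_comm]
    congr 1
    · rw [Finset.sum_eq_single j]
      · simp [mul_comm]
      · intro b _ hb; simp [hb.symm]
      · simp
    · refine Finset.sum_congr rfl fun i _ => by ring

/-- A solution of a linear homogeneous differential equation that vanishes at `0` is zero. -/
theorem eq_zero_of_hasDerivAt_mul {f h : ℝ → ℝ} (hh : Continuous h)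
    (hf : ∀ t, HasDerivAt f (h t * f t) t) (h0 : f 0 = 0) (t : ℝ) : f t = 0 := by
  have key : ∀ s, HasDerivAt (fun s => f s * Real.exp (-∫ x in (0 : ℝ)..s, h x)) 0 s := by
    intro s
    have h1 : HasDerivAt (fun s => ∫ x in (0 : ℝ)..s, h x) (h s) s :=
      intervalIntegral.integral_hasDerivAt_right (hh.intervalIntegrable _ _)
        (hh.stronglyMeasurableAtFilter _ _) hh.continuousAt
    refine ((hf s).mul h1.neg.exp).congr_deriv ?_
    ring
  have hc := is_const_of_deriv_eq_zero (fun s => (key s).differentiableAt)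
    (fun s => (key s).deriv) t 0
  simp only [h0, zero_mul] at hc
  exact (mul_eq_zero.mp hc).resolve_right (Real.exp_pos _).ne'

/-- `F` is an irreducible equation of the set `S`, and it generates the ideal of `S`. -/
structure IsEquationOf (F : MvPolynomial (Fin 3) ℝ) (S : Set E3) : Prop where
  irreducible : Irreducible F
  mem_iff : ∀ p : E3, p ∈ S ↔ MvPolynomial.eval (fun i => p i) F = 0
  dvd : ∀ G : MvPolynomial (Fin 3) ℝ, (∀ p ∈ S, MvPolynomial.eval (fun i => p i) G = 0) → F ∣ G

/-- If a polynomial vector field is tangent to `S`, then its integral curves starting on `S` stay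
on `S`. -/
theorem IsEquationOf.mem_of_integralCurve {F : MvPolynomial (Fin 3) ℝ} {S : Set E3}
    (hF : IsEquationOf F S) (W : Fin 3 → MvPolynomial (Fin 3) ℝ)
    (hW : ∀ p ∈ S, ∑ i, MvPolynomial.eval (fun i => p i) (W i) *
      MvPolynomial.eval (fun i => p i) (MvPolynomial.pderiv i F) = 0)
    (γ : ℝ → E3) (hγ : ∀ t i, HasDerivAt (fun s => γ s i)
      (MvPolynomial.eval (fun i => γ t i) (W i)) t) (h0 : γ 0 ∈ S) (t : ℝ) : γ t ∈ S := by
  -- The derivative of `F` along the field vanishes on `S`, hence equals `F * H`. Along `γ` this is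
  -- the linear equation `f' = (H ∘ γ) f` for `f = F ∘ γ`, with `f 0 = 0`.
  obtain ⟨H, hH⟩ := hF.dvd (∑ i, W i * MvPolynomial.pderiv i F) (by
    intro p hp; simpa using hW p hp)
  rw [hF.mem_iff] at h0 ⊢
  have hcont : Continuous fun s => MvPolynomial.eval (fun i => γ s i) H :=
    continuous_iff_continuousAt.mpr fun s =>
      (hasDerivAt_eval_comp H γ _ s (hγ s)).continuousAt
  refine eq_zero_of_hasDerivAt_mul (f := fun s => MvPolynomial.eval (fun i => γ s i) F)
    hcont (fun s => ?_) h0 t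
  refine (hasDerivAt_eval_comp F γ _ s (hγ s)).congr_deriv ?_
  have := congrArg (MvPolynomial.eval fun i => γ s i) hH
  simp only [map_sum, map_mul] at this
  rw [this, mul_comm]

/-- If a constant vector field is tangent to `S`, then `S` is invariant under translations in that
direction. -/
theorem IsEquationOf.add_smul_mem {F : MvPolynomial (Fin 3) ℝ} {S : Set E3}
    (hF : IsEquationOf F S) (w : E3)
    (hw : ∀ p ∈ S, ∑ i, w i * MvPolynomial.eval (fun i => p i) (MvPolynomial.pderiv i F) = 0)
    (p : E3) (hp : p ∈ S) (t : ℝ) : p + t • w ∈ S := by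
  refine hF.mem_of_integralCurve (fun i => MvPolynomial.C (w i)) (by simpa using hw)
    (fun s => p + s • w) (fun s i => ?_) (by simpa using hp) t
  simpa using ((hasDerivAt_id s).mul_const (w i)).const_add (p i)

/-- A polynomial that vanishes at infinitely many points of a line vanishes on the line. -/
theorem eval_eq_zero_of_infinite (F : MvPolynomial (Fin 3) ℝ) (p w : E3)
    (h : {t : ℝ | MvPolynomial.eval (fun i => (p + t • w) i) F = 0}.Infinite) (t : ℝ) :
    MvPolynomial.eval (fun i => (p + t • w) i) F = 0 := by
  let f : Polynomial ℝ := MvPolynomial.aeval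
    (fun i => Polynomial.C (p i) + Polynomial.X * Polynomial.C (w i)) F
  have hf : ∀ s, f.eval s = MvPolynomial.eval (fun i => (p + s • w) i) F := by
    intro s
    have : (Polynomial.aeval s) f = MvPolynomial.aeval (fun i => (p + s • w) i) F := by
      simp only [f]
      rw [← AlgHom.comp_apply, MvPolynomial.comp_aeval]
      simp only [map_add, map_mul, Polynomial.aeval_C, Polynomial.aeval_X, PiLp.add_apply,
        PiLp.smul_apply, smul_eq_mul]
      rfl
    rw [← Polynomial.coe_aeval_eq_eval, this, MvPolynomial.aeval_eq_eval]
  have : f = 0 := Polynomial.eq_zero_of_infinite_isRoot f (by simpa [Polynomial.IsRoot, hf] using h)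
  rw [← hf, this, Polynomial.eval_zero]

/-- If a fibration by the level sets of a polynomial `φ` leaves `S` saturated, and some line meets
all the level sets, then `S` is one of them. -/
theorem IsEquationOf.exists_level {F : MvPolynomial (Fin 3) ℝ} {S : Set E3}
    (hF : IsEquationOf F S) (φ : MvPolynomial (Fin 3) ℝ) (c e : E3)
    (hS : ∀ p q : E3, MvPolynomial.eval (fun i => p i) φ = MvPolynomial.eval (fun i => q i) φ →
      p ∈ S → q ∈ S)
    (hline : ∀ q : E3, ∃ t : ℝ, MvPolynomial.eval (fun i => (c + t • e) i) φ =
      MvPolynomial.eval (fun i => q i) φ) :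
    ∃ v : ℝ, ∀ q ∈ S, MvPolynomial.eval (fun i => q i) φ = v := by
  set V : Set ℝ := (fun q : E3 => MvPolynomial.eval (fun i => q i) φ) '' S with hV
  by_cases hfin : V.Finite
  -- With finitely many values, the product of the `φ - v` vanishes on `S`, and the prime `F`
  -- divides one factor.
  · have hd : F ∣ ∏ v ∈ hfin.toFinset, (φ - MvPolynomial.C v) := by
      refine hF.dvd _ fun p hp => ?_
      rw [map_prod]
      refine Finset.prod_eq_zero (i := MvPolynomial.eval (fun i => p i) φ) ?_ (by simp)
      rw [Set.Finite.mem_toFinset]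
      exact ⟨p, hp, rfl⟩
    obtain ⟨v, -, hv⟩ := (hF.irreducible.prime.dvd_finsetProd_iff _).mp hd
    refine ⟨v, fun q hq => ?_⟩
    obtain ⟨H, hH⟩ := hv
    have := congrArg (MvPolynomial.eval fun i => q i) hH
    rw [map_mul, (hF.mem_iff q).mp hq] at this
    simpa [sub_eq_zero] using this
  · exfalso
    -- With infinitely many values, `F` has infinitely many zeros on the transversal line, so it
    -- vanishes there. Saturation spreads this to all of space and gives `F = 0`.
    have hinf : {t : ℝ | MvPolynomial.eval (fun i => (c + t • e) i) F = 0}.Infinite := by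
      intro hT
      refine hfin ((hT.image fun t => MvPolynomial.eval (fun i => (c + t • e) i) φ).subset ?_)
      rintro _ ⟨q, hq, rfl⟩
      obtain ⟨t, ht⟩ := hline q
      exact ⟨t, (hF.mem_iff _).mp (hS q _ ht.symm hq), ht⟩
    refine hF.irreducible.ne_zero (MvPolynomial.funext fun x => ?_)
    obtain ⟨t, ht⟩ := hline (WithLp.toLp 2 x)
    have hx := hS _ _ ht ((hF.mem_iff _).mpr (eval_eq_zero_of_infinite F c e hinf t))
    simpa using (hF.mem_iff _).mp hx

open MvPolynomial in
/-- A surface contained in the plane `n₀x + n₁y + n₂z = k` is that plane. -/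
theorem IsEquationOf.eq_of_subset_linear {F : MvPolynomial (Fin 3) ℝ} {S : Set E3}
    (hF : IsEquationOf F S) (n : E3) (hn : n ≠ 0) (k : ℝ)
    (hS : ∀ p ∈ S, n 0 * p 0 + n 1 * p 1 + n 2 * p 2 = k) :
    ∀ p : E3, p ∈ S ↔ n 0 * p 0 + n 1 * p 1 + n 2 * p 2 = k := by
  intro p
  refine ⟨hS p, fun hp => ?_⟩
  set l : MvPolynomial (Fin 3) ℝ := C (n 0) * X 0 + C (n 1) * X 1 + C (n 2) * X 2 - C k with hl
  have hev : ∀ q : E3, eval (fun i => q i) l = n 0 * q 0 + n 1 * q 1 + n 2 * q 2 - k := by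
    intro q; simp [hl]
  obtain ⟨H, hH⟩ := hF.dvd l fun q hq => by rw [hev, hS q hq, sub_self]
  have hl0 : l ≠ 0 := by
    intro h0
    apply hn
    have h00 := hev 0
    -- The values of `l` at `0` and at `n` differ by `‖n‖²`.
    have h1 := hev n
    rw [h0] at h00 h1
    simp at h00 h1
    ext i
    fin_cases i <;> simp <;> nlinarith [sq_nonneg (n 0), sq_nonneg (n 1), sq_nonneg (n 2)]
  have hF0 := hF.irreducible.ne_zero
  have hH0 : H ≠ 0 := by rintro rfl; exact hl0 (by simpa using hH)
  have hdeg : l.totalDegree ≤ 1 := by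
    have hC : ∀ (a : ℝ) (i : Fin 3), (C a * X i : MvPolynomial (Fin 3) ℝ).totalDegree ≤ 1 := by
      intro a i
      exact (totalDegree_mul _ _).trans (by simp)
    refine (totalDegree_sub _ _).trans (max_le ?_ (by simp))
    refine (totalDegree_add _ _).trans (max_le ?_ (hC _ _))
    exact (totalDegree_add _ _).trans (max_le (hC _ _) (hC _ _))
  -- `l = F * H` has degree at most one and `F` is not constant, so `H` is a nonzero constant and
  -- `l`, `F` have the same zeros.
  rw [hH, totalDegree_mul_of_isDomain hF0 hH0] at hdeg
  have hFd : F.totalDegree ≠ 0 := by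
    intro h
    rw [totalDegree_eq_zero_iff_eq_C] at h
    apply hF.irreducible.not_isUnit
    rw [h] at hF0 ⊢
    refine (IsUnit.mk0 (coeff 0 F) ?_).map C
    rintro h'
    simp [h'] at hF0
  have hHd : H.totalDegree = 0 := by omega
  rw [totalDegree_eq_zero_iff_eq_C] at hHd
  have h2 := hev p
  rw [hp, sub_self, hH, map_mul] at h2
  rw [hF.mem_iff]
  refine (mul_eq_zero.mp h2).resolve_right ?_
  rw [hHd, eval_C]
  intro h
  apply hH0
  rw [hHd, h, map_zero]

/-! ### Coordinates and the cross product. -/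

theorem inner_eq_coords (x y : E3) : inner ℝ x y = x 0 * y 0 + x 1 * y 1 + x 2 * y 2 := by
  simp [PiLp.inner_apply, Fin.sum_univ_three, mul_comm]

theorem norm_sq_eq_coords (x : E3) : ‖x‖ ^ 2 = x 0 ^ 2 + x 1 ^ 2 + x 2 ^ 2 := by
  rw [← real_inner_self_eq_norm_sq, inner_eq_coords]; ring

theorem norm_eq_norm_iff_coords (x y : E3) :
    ‖x‖ = ‖y‖ ↔ x 0 ^ 2 + x 1 ^ 2 + x 2 ^ 2 = y 0 ^ 2 + y 1 ^ 2 + y 2 ^ 2 := by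
  rw [← norm_sq_eq_coords, ← norm_sq_eq_coords, sq_eq_sq₀ (norm_nonneg _) (norm_nonneg _)]

/-- The cross product on `E3`. -/
def cross (x y : E3) : E3 :=
  !₂[x 1 * y 2 - x 2 * y 1, x 2 * y 0 - x 0 * y 2, x 0 * y 1 - x 1 * y 0]

@[simp] theorem cross_apply_zero (x y : E3) : cross x y 0 = x 1 * y 2 - x 2 * y 1 := rfl
@[simp] theorem cross_apply_one (x y : E3) : cross x y 1 = x 2 * y 0 - x 0 * y 2 := rfl
@[simp] theorem cross_apply_two (x y : E3) : cross x y 2 = x 0 * y 1 - x 1 * y 0 := rfl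

theorem E3.ext_coords {x y : E3} (h0 : x 0 = y 0) (h1 : x 1 = y 1) (h2 : x 2 = y 2) : x = y := by
  ext i; fin_cases i <;> assumption

theorem E3.ne_zero_of_norm_one {u : E3} (hu : ‖u‖ = 1) : u ≠ 0 := by
  rintro rfl; simp at hu

/-! ### Axes of revolution and their rotation fields. -/

/-- The set `S` is invariant under rotations about the line through `a` in direction `u`: membership
of a point depends only on its height along the line and its distance from `a`. -/
def RevInvariant (a u : E3) (S : Set E3) : Prop :=
  ∀ p q : E3, inner ℝ u (q - a) = inner ℝ u (p - a) → ‖q - a‖ = ‖p - a‖ → p ∈ S → q ∈ S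

/-- Transport of an axis of revolution along a symmetry of `S`. -/
theorem RevInvariant.conj {b v b' v' : E3} {S : Set E3} (h : RevInvariant b v S) (σ : E3 → E3)
    (hσ : Function.Involutive σ) (hS : ∀ p ∈ S, σ p ∈ S)
    (hinner : ∀ p, inner ℝ v (σ p - b) = inner ℝ v' (p - b')) (hnorm : ∀ p, ‖σ p - b‖ = ‖p - b'‖) :
    RevInvariant b' v' S := by
  intro p q h1 h2 hp
  rw [← hσ q]
  exact hS _ (h (σ p) (σ q) (by rw [hinner, hinner, h1]) (by rw [hnorm, hnorm, h2]) (hS p hp))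

theorem RevInvariant.of_mem_axis {a u : E3} {S : Set E3} (h : RevInvariant a u S) (t : ℝ) :
    RevInvariant (a + t • u) u S := by
  intro p q h1 h2 hp
  simp only [norm_eq_norm_iff_coords, inner_eq_coords, PiLp.sub_apply, PiLp.add_apply,
    PiLp.smul_apply, smul_eq_mul] at h1 h2
  refine h p q ?_ ?_ hp
  · simp only [inner_eq_coords, PiLp.sub_apply]
    linear_combination h1
  · simp only [norm_eq_norm_iff_coords, PiLp.sub_apply]
    linear_combination h2 + 2 * t * h1

theorem RevInvariant.of_smul {a u : E3} {S : Set E3} {s : ℝ} (h : RevInvariant a (s • u) S) :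
    RevInvariant a u S := by
  intro p q h1 h2 hp
  exact h p q (by rw [inner_smul_left, inner_smul_left, h1]) h2 hp

/-- The gradient of a polynomial. -/
noncomputable def polyGrad (F : MvPolynomial (Fin 3) ℝ) (p : E3) : E3 :=
  WithLp.toLp 2 fun i => MvPolynomial.eval (fun i => p i) (MvPolynomial.pderiv i F)

theorem sum_mul_pderiv_eq_inner (F : MvPolynomial (Fin 3) ℝ) (p w : E3) :
    ∑ i, w i * MvPolynomial.eval (fun i => p i) (MvPolynomial.pderiv i F) =
      inner ℝ w (polyGrad F p) := by
  simp [inner_eq_coords, Fin.sum_univ_three, polyGrad]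

/-- The rotation field of an axis of revolution is tangent to the surface. -/
theorem IsEquationOf.inner_cross_polyGrad {F : MvPolynomial (Fin 3) ℝ} {S : Set E3}
    (hF : IsEquationOf F S) {a u : E3} (hu : ‖u‖ = 1) (h : RevInvariant a u S) {p : E3}
    (hp : p ∈ S) : inner ℝ (cross u (p - a)) (polyGrad F p) = 0 := by
  have hu' : u 0 ^ 2 + u 1 ^ 2 + u 2 ^ 2 = 1 := by rw [← norm_sq_eq_coords, hu, one_pow]
  set k : ℝ := inner ℝ u (p - a) with hk
  have hk' : k = u 0 * (p 0 - a 0) + u 1 * (p 1 - a 1) + u 2 * (p 2 - a 2) := by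
    simp [hk, inner_eq_coords]
  -- The orbit of `p` under the rotations, by Rodrigues' formula. It stays on `S`, so `F ∘ γ` is
  -- zero; its derivative at `0` is the claim.
  let γ : ℝ → E3 := fun t =>
    a + k • u + Real.cos t • (p - a - k • u) + Real.sin t • cross u (p - a)
  have hγS : ∀ t, γ t ∈ S := by
    intro t
    refine h p _ ?_ ?_ hp
    · simp only [inner_eq_coords, γ, PiLp.sub_apply, PiLp.add_apply, PiLp.smul_apply, smul_eq_mul,
        cross_apply_zero, cross_apply_one, cross_apply_two]
      linear_combination (k - Real.cos t * k) * hu' + (1 - Real.cos t) * hk'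
    · simp only [norm_eq_norm_iff_coords, γ, PiLp.sub_apply, PiLp.add_apply, PiLp.smul_apply,
        smul_eq_mul, cross_apply_zero, cross_apply_one, cross_apply_two]
      have hcs := Real.sin_sq_add_cos_sq t
      rw [hk']
      linear_combination ((u 0 * (p 0 - a 0) + u 1 * (p 1 - a 1) + u 2 * (p 2 - a 2)) ^ 2 *
          (1 - Real.cos t) ^ 2 + Real.sin t ^ 2 *
            ((p 0 - a 0) ^ 2 + (p 1 - a 1) ^ 2 + (p 2 - a 2) ^ 2)) * hu' +
        ((p 0 - a 0) ^ 2 + (p 1 - a 1) ^ 2 + (p 2 - a 2) ^ 2 -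
          (u 0 * (p 0 - a 0) + u 1 * (p 1 - a 1) + u 2 * (p 2 - a 2)) ^ 2) * hcs
  have hd : ∀ i, HasDerivAt (fun s => γ s i) (cross u (p - a) i) 0 := by
    intro i
    have h1 := ((Real.hasDerivAt_cos 0).mul_const ((p - a - k • u) i)).const_add ((a + k • u) i)
    have h2 := h1.add ((Real.hasDerivAt_sin 0).mul_const (cross u (p - a) i))
    refine h2.congr_deriv ?_
    simp
  have h0 := hasDerivAt_eval_comp F γ _ 0 hd
  have hγ0 : γ 0 = p := by simp [γ]
  rw [hγ0, sum_mul_pderiv_eq_inner] at h0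
  refine h0.unique ?_
  have : (fun s => MvPolynomial.eval (fun i => γ s i) F) = fun _ => 0 :=
    funext fun s => (hF.mem_iff _).mp (hγS s)
  rw [this]
  exact hasDerivAt_const _ _

theorem IsEquationOf.translation_invariant {F : MvPolynomial (Fin 3) ℝ} {S : Set E3}
    (hF : IsEquationOf F S) (w : E3) (hw : ∀ p ∈ S, inner ℝ w (polyGrad F p) = 0) :
    ∀ p ∈ S, ∀ t : ℝ, p + t • w ∈ S :=
  hF.add_smul_mem w fun p hp => by rw [sum_mul_pderiv_eq_inner]; exact hw p hp

theorem coords_sq_of_norm_one {u : E3} (hu : ‖u‖ = 1) : u 0 ^ 2 + u 1 ^ 2 + u 2 ^ 2 = 1 := by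
  rw [← norm_sq_eq_coords, hu, one_pow]

/-- This is `u × (u × x) = ⟪u, x⟫ u - x`, read in coordinates. -/
theorem eq_inner_smul_of_cross_eq_zero {u x : E3} (hu : ‖u‖ = 1) (h : cross u x = 0) :
    x = (inner ℝ u x : ℝ) • u := by
  have hu' := coords_sq_of_norm_one hu
  have h0 := congrArg (fun y : E3 => y 0) h
  have h1 := congrArg (fun y : E3 => y 1) h
  have h2 := congrArg (fun y : E3 => y 2) h
  simp only [cross_apply_zero, cross_apply_one, cross_apply_two, PiLp.zero_apply] at h0 h1 h2
  apply E3.ext_coords <;> simp only [inner_eq_coords, PiLp.smul_apply, smul_eq_mul]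
  · linear_combination -x 0 * hu' - u 1 * h2 + u 2 * h1
  · linear_combination -x 1 * hu' + u 0 * h2 - u 2 * h0
  · linear_combination -x 2 * hu' - u 0 * h1 + u 1 * h0

theorem exists_eq_smul_add_smul {w₁ w₂ x : E3} (hw : cross w₁ w₂ ≠ 0)
    (hx : inner ℝ (cross w₁ w₂) x = 0) : ∃ s t : ℝ, x = s • w₁ + t • w₂ := by
  have hN : (‖cross w₁ w₂‖ ^ 2 : ℝ) ≠ 0 := by simpa using hw
  -- If `x = s w₁ + t w₂`, then `x × w₂ = s (w₁ × w₂)` and `w₁ × x = t (w₁ × w₂)`; pairing with `w₁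
  -- × w₂` isolates `s` and `t`.
  refine ⟨inner ℝ (cross x w₂) (cross w₁ w₂) / ‖cross w₁ w₂‖ ^ 2,
    inner ℝ (cross w₁ x) (cross w₁ w₂) / ‖cross w₁ w₂‖ ^ 2, ?_⟩
  rw [inner_eq_coords] at hx
  simp only [cross_apply_zero, cross_apply_one, cross_apply_two] at hx
  apply E3.ext_coords <;> simp only [PiLp.add_apply, PiLp.smul_apply, smul_eq_mul] <;>
    field_simp <;>
    simp only [inner_eq_coords, norm_sq_eq_coords, cross_apply_zero, cross_apply_one,
      cross_apply_two]
  · linear_combination (w₁ 1 * w₂ 2 - w₁ 2 * w₂ 1) * hx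
  · linear_combination (w₁ 2 * w₂ 0 - w₁ 0 * w₂ 2) * hx
  · linear_combination (w₁ 0 * w₂ 1 - w₁ 1 * w₂ 0) * hx

theorem exists_norm_one_orthogonal (x y : E3) :
    ∃ n : E3, ‖n‖ = 1 ∧ inner ℝ n x = 0 ∧ inner ℝ n y = 0 := by
  have hne : (Submodule.span ℝ (Set.range ![x, y]))ᗮ ≠ ⊥ := by
    rw [Ne, Submodule.orthogonal_eq_bot_iff]
    intro h
    have h1 := finrank_range_le_card (R := ℝ) ![x, y]
    rw [Set.finrank, h, finrank_top] at h1
    simp at h1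
  obtain ⟨m, hm, hm0⟩ := Submodule.exists_mem_ne_zero_of_ne_bot hne
  rw [Submodule.mem_orthogonal'] at hm
  have hx := hm x (Submodule.subset_span ⟨0, rfl⟩)
  have hy := hm y (Submodule.subset_span ⟨1, rfl⟩)
  refine ⟨(‖m‖⁻¹ : ℝ) • m, norm_smul_inv_norm hm0, ?_, ?_⟩
  · rw [real_inner_smul_left, hx, mul_zero]
  · rw [real_inner_smul_left, hy, mul_zero]

theorem isPlaneSet_of_linear {S : Set E3} {n : E3} (hn : n ≠ 0) (k : ℝ)
    (hS : ∀ p : E3, p ∈ S ↔ inner ℝ n p = k) : IsPlaneSet S := by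
  have hN : (inner ℝ n n : ℝ) ≠ 0 := by simpa using hn
  have hmem : ∀ p, p ∈ AffineSubspace.mk' ((k / inner ℝ n n : ℝ) • n) (Submodule.span ℝ {n})ᗮ ↔
      inner ℝ n p = k := by
    intro p
    rw [AffineSubspace.mem_mk', Submodule.mem_orthogonal_singleton_iff_inner_right, vsub_eq_sub,
      inner_sub_right, inner_smul_right, div_mul_cancel₀ _ hN, sub_eq_zero]
  refine ⟨AffineSubspace.mk' ((k / inner ℝ n n : ℝ) • n) (Submodule.span ℝ {n})ᗮ,
    ⟨⟨_, AffineSubspace.self_mem_mk' _ _⟩, ?_⟩, ?_⟩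
  · rw [AffineSubspace.direction_mk']
    have : Fact (Module.finrank ℝ E3 = 2 + 1) := ⟨by simp⟩
    exact Submodule.finrank_orthogonal_span_singleton hn
  · ext p
    rw [hS, SetLike.mem_coe, hmem]

/-! ### Two axes of revolution force a sphere. -/

namespace IsEquationOf

variable {F : MvPolynomial (Fin 3) ℝ} {S : Set E3}

/-- This also yields that `S` is nonempty, since an empty set satisfies the excluded condition
vacuously. -/
theorem not_subset_plane (hF : IsEquationOf F S) (hpl : ¬ IsPlaneSet S) {n : E3} (hn : n ≠ 0)
    (k : ℝ) : ¬ ∀ p ∈ S, inner ℝ n p = k := by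
  intro h
  have := hF.eq_of_subset_linear n hn k fun p hp => by rw [← inner_eq_coords, h p hp]
  exact hpl (isPlaneSet_of_linear hn k fun p => by rw [this p, inner_eq_coords])

/-- The linear form `p ↦ ⟪n, p - c⟫` as a polynomial. -/
noncomputable def linForm (n c : E3) : MvPolynomial (Fin 3) ℝ :=
  ∑ i, MvPolynomial.C (n i) * (MvPolynomial.X i - MvPolynomial.C (c i))

theorem eval_linForm (n c p : E3) :
    MvPolynomial.eval (fun i => p i) (linForm n c) = inner ℝ n (p - c) := by
  simp [linForm, inner_eq_coords, Fin.sum_univ_three]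

/-- Two independent translation directions would make `S` a union of parallel planes, the level sets
of the form with normal `w₁ × w₂`. By `exists_level` it would lie in one of them. -/
theorem not_translation_invariant (hF : IsEquationOf F S) (hpl : ¬ IsPlaneSet S) {w₁ w₂ : E3}
    (h1 : ∀ p ∈ S, ∀ t : ℝ, p + t • w₁ ∈ S) (h2 : ∀ p ∈ S, ∀ t : ℝ, p + t • w₂ ∈ S) :
    cross w₁ w₂ = 0 := by
  by_contra hw
  have hN : (inner ℝ (cross w₁ w₂) (cross w₁ w₂) : ℝ) ≠ 0 := by simpa using hw
  obtain ⟨k, hk⟩ := hF.exists_level (linForm (cross w₁ w₂) 0) 0 (cross w₁ w₂)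
    (fun p q hpq hp => by
      simp only [eval_linForm, sub_zero] at hpq
      obtain ⟨s, t, hst⟩ := exists_eq_smul_add_smul (x := q - p) hw
        (by rw [inner_sub_right, hpq, sub_self])
      rw [← add_sub_cancel p q, hst, ← add_assoc]
      exact h2 _ (h1 p hp s) t)
    (fun q => ⟨inner ℝ (cross w₁ w₂) q / inner ℝ (cross w₁ w₂) (cross w₁ w₂), by
      simp only [eval_linForm, sub_zero, zero_add, inner_smul_right]
      exact div_mul_cancel₀ _ hN⟩)
  exact hF.not_subset_plane hpl hw k fun p hp => by simpa [eval_linForm] using hk p hp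

/-- If `S` has two skew axes of revolution, then it is cylindrical along both of them. -/
theorem inner_polyGrad_of_skew (hF : IsEquationOf F S) {a u b v : E3} (hu : ‖u‖ = 1) (hv : ‖v‖ = 1)
    (ha : RevInvariant a u S) (hb : RevInvariant b v S) (hT : inner ℝ (cross u v) (b - a) ≠ 0)
    (p : E3) (hp : p ∈ S) : inner ℝ u (polyGrad F p) = 0 := by
  have hu' := coords_sq_of_norm_one hu
  let κ : ℝ := inner ℝ u v
  -- The half-turn about the first axis. It preserves `S` and sends the second axis to a third one,
  -- through `σ b` with direction `2κu - v`.
  let σ : E3 → E3 := fun x => a + (2 * inner ℝ u (x - a) : ℝ) • u - (x - a)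
  have hσ : Function.Involutive σ := by
    intro x
    apply E3.ext_coords <;>
      simp only [σ, inner_eq_coords, PiLp.sub_apply, PiLp.add_apply, PiLp.smul_apply, smul_eq_mul]
    · linear_combination 4 * u 0 *
        (u 0 * (x 0 - a 0) + u 1 * (x 1 - a 1) + u 2 * (x 2 - a 2)) * hu'
    · linear_combination 4 * u 1 *
        (u 0 * (x 0 - a 0) + u 1 * (x 1 - a 1) + u 2 * (x 2 - a 2)) * hu'
    · linear_combination 4 * u 2 *
        (u 0 * (x 0 - a 0) + u 1 * (x 1 - a 1) + u 2 * (x 2 - a 2)) * hu'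
  have hσS : ∀ x ∈ S, σ x ∈ S := by
    intro x hx
    refine ha x _ ?_ ?_ hx
    · simp only [σ, inner_eq_coords, PiLp.sub_apply, PiLp.add_apply, PiLp.smul_apply, smul_eq_mul]
      linear_combination 2 *
        (u 0 * (x 0 - a 0) + u 1 * (x 1 - a 1) + u 2 * (x 2 - a 2)) * hu'
    · simp only [σ, norm_eq_norm_iff_coords, inner_eq_coords, PiLp.sub_apply, PiLp.add_apply,
        PiLp.smul_apply, smul_eq_mul]
      linear_combination 4 *
        (u 0 * (x 0 - a 0) + u 1 * (x 1 - a 1) + u 2 * (x 2 - a 2)) ^ 2 * hu'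
  have hc : RevInvariant (σ b) ((2 * κ) • u - v) S := by
    refine hb.conj σ hσ hσS (fun x => ?_) (fun x => ?_)
    · simp only [σ, κ, inner_eq_coords, PiLp.sub_apply, PiLp.add_apply, PiLp.smul_apply,
        smul_eq_mul]
      linear_combination 4 * (u 0 * v 0 + u 1 * v 1 + u 2 * v 2) *
        (u 0 * (b 0 - a 0) + u 1 * (b 1 - a 1) + u 2 * (b 2 - a 2)) * hu'
    · simp only [σ, norm_eq_norm_iff_coords, inner_eq_coords, PiLp.sub_apply, PiLp.add_apply,
        PiLp.smul_apply, smul_eq_mul]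
      linear_combination 4 * ((u 0 * (x 0 - a 0) + u 1 * (x 1 - a 1) + u 2 * (x 2 - a 2)) ^ 2 -
        (u 0 * (b 0 - a 0) + u 1 * (b 1 - a 1) + u 2 * (b 2 - a 2)) ^ 2) * hu'
  have hv1 : ‖(2 * κ) • u - v‖ = 1 := by
    rw [← hv, norm_eq_norm_iff_coords]
    simp only [κ, inner_eq_coords, PiLp.sub_apply, PiLp.smul_apply, smul_eq_mul]
    linear_combination 4 * (u 0 * v 0 + u 1 * v 1 + u 2 * v 2) ^ 2 * hu'
  have e1 := hF.inner_cross_polyGrad hu ha hp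
  have e2 := hF.inner_cross_polyGrad hv hb hp
  have e3 := hF.inner_cross_polyGrad hv1 hc hp
  -- The directions satisfy `v + (2κu - v) - 2κu = 0`, so the same combination of the three rotation
  -- fields is constant. It is a nonzero multiple of `u` exactly because the axes are skew.
  have key : cross v (p - b) + cross ((2 * κ) • u - v) (p - σ b) - (2 * κ) • cross u (p - a) =
      (-2 * inner ℝ (cross u v) (b - a) : ℝ) • u := by
    apply E3.ext_coords <;>
      simp only [σ, κ, inner_eq_coords, PiLp.sub_apply, PiLp.add_apply, PiLp.smul_apply,
        smul_eq_mul, cross_apply_zero, cross_apply_one, cross_apply_two]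
    · linear_combination 2 * (v 1 * (b 2 - a 2) - v 2 * (b 1 - a 1)) * hu'
    · linear_combination 2 * (v 2 * (b 0 - a 0) - v 0 * (b 2 - a 2)) * hu'
    · linear_combination 2 * (v 0 * (b 1 - a 1) - v 1 * (b 0 - a 0)) * hu'
  have := congrArg (fun w => (inner ℝ w (polyGrad F p) : ℝ)) key
  rw [inner_sub_left, inner_add_left, real_inner_smul_left, real_inner_smul_left, e1, e2, e3,
    mul_zero, add_zero, sub_zero, zero_eq_mul] at this
  exact this.resolve_left (mul_ne_zero (by norm_num) hT)

/-- If `S` has two distinct parallel axes of revolution, then its tangent spaces contain the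
direction perpendicular to the plane of the axes. -/
theorem inner_polyGrad_of_parallel (hF : IsEquationOf F S) {a u b : E3} (hu : ‖u‖ = 1)
    (ha : RevInvariant a u S) (hb : RevInvariant b u S) (p : E3) (hp : p ∈ S) :
    inner ℝ (cross u (b - a)) (polyGrad F p) = 0 := by
  have e1 := hF.inner_cross_polyGrad hu ha hp
  have e2 := hF.inner_cross_polyGrad hu hb hp
  have key : cross u (b - a) = cross u (p - a) - cross u (p - b) := by
    apply E3.ext_coords <;>
      simp only [PiLp.sub_apply, cross_apply_zero, cross_apply_one, cross_apply_two] <;> ring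
  rw [key, inner_sub_left, e1, e2, sub_zero]

/-- Translation invariance perpendicular to an axis of revolution turns by a right angle. -/
theorem _root_.RevInvariant.cross_translation {a u w : E3} (hu : ‖u‖ = 1)
    (ha : RevInvariant a u S) (huw : inner ℝ u w = 0) (hw : ∀ p ∈ S, ∀ t : ℝ, p + t • w ∈ S) :
    ∀ p ∈ S, ∀ t : ℝ, p + t • cross u w ∈ S := by
  have hu' := coords_sq_of_norm_one hu
  have huw' := huw
  rw [inner_eq_coords] at huw'
  have hnorm : ‖w‖ = ‖cross u w‖ := by
    rw [norm_eq_norm_iff_coords]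
    simp only [cross_apply_zero, cross_apply_one, cross_apply_two]
    linear_combination -(w 0 ^ 2 + w 1 ^ 2 + w 2 ^ 2) * hu' +
      (u 0 * w 0 + u 1 * w 1 + u 2 * w 2) * huw'
  -- This mirror exchanges `w` and `u × w`, which have equal norms, and fixes `u`. It therefore
  -- preserves `S` and conjugates one translation into the other.
  set K := (Submodule.span ℝ {w - cross u w})ᗮ with hK
  have hρw : K.reflection w = cross u w := Submodule.reflection_sub hnorm
  have hρu : K.reflection u = u := by
    refine Submodule.reflection_mem_subspace_eq_self ?_
    rw [hK, Submodule.mem_orthogonal_singleton_iff_inner_left, inner_sub_right, huw, zero_sub,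
      neg_eq_zero, inner_eq_coords]
    simp only [cross_apply_zero, cross_apply_one, cross_apply_two]
    ring
  have hρ : ∀ p ∈ S, a + K.reflection (p - a) ∈ S := by
    intro p hp
    refine ha p _ ?_ ?_ hp
    · rw [add_sub_cancel_left]
      nth_rewrite 1 [← hρu]
      exact LinearIsometryEquiv.inner_map_map _ _ _
    · rw [add_sub_cancel_left, LinearIsometryEquiv.norm_map]
  intro p hp t
  have := hρ _ (hw _ (hρ p hp) t)
  rwa [add_assoc, add_sub_cancel_left, map_add, map_smul, hρw, Submodule.reflection_reflection,
    ← add_assoc, add_sub_cancel] at this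

/-- The rotation field `p ↦ y × (p - c)` as a triple of polynomials. -/
noncomputable def rotField (y c : E3) : Fin 3 → MvPolynomial (Fin 3) ℝ :=
  ![linForm !₂[0, -y 2, y 1] c, linForm !₂[y 2, 0, -y 0] c, linForm !₂[-y 1, y 0, 0] c]

theorem eval_rotField (y c p : E3) (i : Fin 3) :
    MvPolynomial.eval (fun i => p i) (rotField y c i) = cross y (p - c) i := by
  fin_cases i
  · change MvPolynomial.eval (fun i => p i) (linForm _ _) = _
    rw [eval_linForm, inner_eq_coords]
    simp; ring
  · change MvPolynomial.eval (fun i => p i) (linForm _ _) = _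
    rw [eval_linForm, inner_eq_coords]
    simp; ring
  · change MvPolynomial.eval (fun i => p i) (linForm _ _) = _
    rw [eval_linForm, inner_eq_coords]
    simp; ring

/-- If `S` has two axes of revolution that meet in `c`, then all rotation fields around `c` are
tangent to `S`. -/
theorem inner_polyGrad_of_concurrent (hF : IsEquationOf F S) (hpl : ¬ IsPlaneSet S) {c u v : E3}
    (hu : ‖u‖ = 1) (hv : ‖v‖ = 1) (ha : RevInvariant c u S) (hb : RevInvariant c v S)
    (huv : cross u v ≠ 0) (y p : E3) (hp : p ∈ S) :
    inner ℝ (cross y (p - c)) (polyGrad F p) = 0 := by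
  have hsum : ∀ q : E3, MvPolynomial.eval (fun i => q i)
      (∑ i, rotField y c i * MvPolynomial.pderiv i F) =
        inner ℝ (cross y (q - c)) (polyGrad F q) := by
    intro q
    rw [← sum_mul_pderiv_eq_inner]
    simp [eval_rotField]
  -- Where `⟪u × v, x⟫ ≠ 0`, with `x = q - c`, the vectors `u × x` and `v × x` span the plane
  -- orthogonal to `x`, which contains `y × x`. Multiplying by this form clears the denominator;
  -- primality of `F` then removes the factor, as `S` is not in a plane.
  have hd : F ∣ linForm (cross u v) c * ∑ i, rotField y c i * MvPolynomial.pderiv i F := by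
    refine hF.dvd _ fun q hq => ?_
    have e1 := hF.inner_cross_polyGrad hu ha hq
    have e2 := hF.inner_cross_polyGrad hv hb hq
    rw [map_mul, hsum, eval_linForm]
    generalize polyGrad F q = g at *
    generalize q - c = x at *
    simp only [inner_eq_coords, cross_apply_zero, cross_apply_one, cross_apply_two] at *
    linear_combination (y 0 * (v 1 * x 2 - v 2 * x 1) + y 1 * (v 2 * x 0 - v 0 * x 2) +
      y 2 * (v 0 * x 1 - v 1 * x 0)) * e1 - (y 0 * (u 1 * x 2 - u 2 * x 1) +
      y 1 * (u 2 * x 0 - u 0 * x 2) + y 2 * (u 0 * x 1 - u 1 * x 0)) * e2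
  rcases hF.irreducible.prime.dvd_or_dvd hd with h | h
  · exfalso
    refine hF.not_subset_plane hpl huv (inner ℝ (cross u v) c) fun q hq => ?_
    obtain ⟨H, hH⟩ := h
    have := congrArg (MvPolynomial.eval fun i => q i) hH
    rwa [map_mul, (hF.mem_iff q).mp hq, zero_mul, eval_linForm, inner_sub_right,
      sub_eq_zero] at this
  · obtain ⟨H, hH⟩ := h
    rw [← hsum, hH, map_mul, (hF.mem_iff p).mp hp, zero_mul]

theorem _root_.exists_cos_sin_eq {α β : ℝ} (h : α ^ 2 + β ^ 2 = 1) :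
    ∃ θ : ℝ, Real.cos θ = α ∧ Real.sin θ = β := by
  have hz : ‖(⟨α, β⟩ : ℂ)‖ = 1 := by
    rw [← sq_eq_sq₀ (norm_nonneg _) zero_le_one, Complex.sq_norm, Complex.normSq_mk]
    linarith
  refine ⟨Complex.arg ⟨α, β⟩, ?_, ?_⟩
  · rw [Complex.cos_arg (by rintro h0; simp [h0] at hz), hz, div_one]
  · rw [Complex.sin_arg, hz, div_one]

/-- If all rotation fields around `c` are tangent to `S`, then `S` is a union of spheres. -/
theorem mem_of_norm_eq (hF : IsEquationOf F S) {c : E3}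
    (h : ∀ y, ∀ p ∈ S, inner ℝ (cross y (p - c)) (polyGrad F p) = 0) {p q : E3}
    (hpq : ‖q - c‖ = ‖p - c‖) (hp : p ∈ S) : q ∈ S := by
  by_cases hx : p - c = 0
  · rw [hx, norm_zero, norm_eq_zero, sub_eq_zero] at hpq
    rwa [hpq, ← sub_eq_zero.mp hx]
  -- Both points lie on a circle around `c` in the plane normal to `n`. This circle is an integral
  -- curve of the rotation field of `n`.
  obtain ⟨n, hn, hnx, hny⟩ := exists_norm_one_orthogonal (p - c) (q - c)
  have hn' := coords_sq_of_norm_one hn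
  obtain ⟨x, hxdef⟩ : ∃ x, x = p - c := ⟨_, rfl⟩
  obtain ⟨z, hzdef⟩ : ∃ z, z = q - c := ⟨_, rfl⟩
  rw [← hxdef] at hx hnx hpq
  rw [← hzdef] at hny hpq
  have hN : ‖x‖ ^ 2 ≠ 0 := by simpa using hx
  have hN' := norm_sq_eq_coords x
  have hz' := norm_sq_eq_coords z
  rw [hpq] at hz'
  have hnx' := hnx
  have hny' := hny
  rw [inner_eq_coords] at hnx' hny'
  obtain ⟨θ, hc, hs⟩ := exists_cos_sin_eq (α := inner ℝ x z / ‖x‖ ^ 2)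
    (β := inner ℝ (cross n x) z / ‖x‖ ^ 2) (by
      field_simp
      simp only [inner_eq_coords, cross_apply_zero, cross_apply_one, cross_apply_two]
      linear_combination ((x 0 ^ 2 + x 1 ^ 2 + x 2 ^ 2) * (z 0 ^ 2 + z 1 ^ 2 + z 2 ^ 2) -
          (x 0 * z 0 + x 1 * z 1 + x 2 * z 2) ^ 2) * hn' -
        ((n 0 * z 0 + n 1 * z 1 + n 2 * z 2) * (x 0 ^ 2 + x 1 ^ 2 + x 2 ^ 2) -
          2 * (n 0 * x 0 + n 1 * x 1 + n 2 * x 2) * (x 0 * z 0 + x 1 * z 1 + x 2 * z 2)) * hny' -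
        (n 0 * x 0 + n 1 * x 1 + n 2 * x 2) * (z 0 ^ 2 + z 1 ^ 2 + z 2 ^ 2) * hnx' -
        ‖x‖ ^ 2 * hz' - (z 0 ^ 2 + z 1 ^ 2 + z 2 ^ 2) * hN')
  let γ : ℝ → E3 := fun t => c + Real.cos t • x + Real.sin t • cross n x
  have hγθ : γ θ = q := by
    have : q = c + z := by rw [hzdef, add_sub_cancel]
    simp only [γ, this, hc, hs, add_assoc]
    congr 1
    apply E3.ext_coords <;> simp only [PiLp.add_apply, PiLp.smul_apply, smul_eq_mul] <;>
      field_simp <;>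
      simp only [inner_eq_coords, cross_apply_zero, cross_apply_one, cross_apply_two]
    · linear_combination -((x 0 * z 0 + x 1 * z 1 + x 2 * z 2) * x 0 -
        (x 0 ^ 2 + x 1 ^ 2 + x 2 ^ 2) * z 0) * hn' - n 0 * (x 0 ^ 2 + x 1 ^ 2 + x 2 ^ 2) * hny' +
        (n 0 * (x 0 * z 0 + x 1 * z 1 + x 2 * z 2) + x 0 * (n 0 * z 0 + n 1 * z 1 + n 2 * z 2) -
          z 0 * (n 0 * x 0 + n 1 * x 1 + n 2 * x 2)) * hnx' - z 0 * hN'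
    · linear_combination -((x 0 * z 0 + x 1 * z 1 + x 2 * z 2) * x 1 -
        (x 0 ^ 2 + x 1 ^ 2 + x 2 ^ 2) * z 1) * hn' - n 1 * (x 0 ^ 2 + x 1 ^ 2 + x 2 ^ 2) * hny' +
        (n 1 * (x 0 * z 0 + x 1 * z 1 + x 2 * z 2) + x 1 * (n 0 * z 0 + n 1 * z 1 + n 2 * z 2) -
          z 1 * (n 0 * x 0 + n 1 * x 1 + n 2 * x 2)) * hnx' - z 1 * hN'
    · linear_combination -((x 0 * z 0 + x 1 * z 1 + x 2 * z 2) * x 2 -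
        (x 0 ^ 2 + x 1 ^ 2 + x 2 ^ 2) * z 2) * hn' - n 2 * (x 0 ^ 2 + x 1 ^ 2 + x 2 ^ 2) * hny' +
        (n 2 * (x 0 * z 0 + x 1 * z 1 + x 2 * z 2) + x 2 * (n 0 * z 0 + n 1 * z 1 + n 2 * z 2) -
          z 2 * (n 0 * x 0 + n 1 * x 1 + n 2 * x 2)) * hnx' - z 2 * hN'
  rw [← hγθ]
  refine hF.mem_of_integralCurve (rotField n c) (fun p hp => ?_) γ (fun t i => ?_) ?_ θ
  · simp only [eval_rotField]
    rw [sum_mul_pderiv_eq_inner, h n p hp]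
  · have hcr : cross n (γ t - c) = (-Real.sin t) • x + Real.cos t • cross n x := by
      apply E3.ext_coords <;>
        simp only [γ, PiLp.add_apply, PiLp.sub_apply, PiLp.smul_apply, smul_eq_mul,
          cross_apply_zero, cross_apply_one, cross_apply_two]
      · linear_combination -Real.sin t * x 0 * hn' + Real.sin t * n 0 * hnx'
      · linear_combination -Real.sin t * x 1 * hn' + Real.sin t * n 1 * hnx'
      · linear_combination -Real.sin t * x 2 * hn' + Real.sin t * n 2 * hnx'
    have h1 := ((Real.hasDerivAt_cos t).mul_const (x i)).const_add (c i)
    refine (h1.add ((Real.hasDerivAt_sin t).mul_const (cross n x i))).congr_deriv ?_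
    rw [eval_rotField, hcr]
    simp
  · simpa [γ, hxdef] using hp

/-- `S` is a union of level sets of the squared distance from `c`, hence lies in one of them by
`exists_level`. Radius zero is impossible, since a point lies in a plane. -/
theorem isSphereSet_of_tangent (hF : IsEquationOf F S) (hpl : ¬ IsPlaneSet S) {c : E3}
    (h : ∀ y, ∀ p ∈ S, inner ℝ (cross y (p - c)) (polyGrad F p) = 0) : IsSphereSet S := by
  obtain ⟨n, hn, -⟩ := exists_norm_one_orthogonal 0 0
  have hn0 := E3.ne_zero_of_norm_one hn
  let φ : MvPolynomial (Fin 3) ℝ := ∑ i, (MvPolynomial.X i - MvPolynomial.C (c i)) ^ 2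
  have hφ : ∀ p : E3, MvPolynomial.eval (fun i => p i) φ = ‖p - c‖ ^ 2 := by
    intro p
    simp [φ, norm_sq_eq_coords, Fin.sum_univ_three]
  obtain ⟨k, hk⟩ := hF.exists_level φ c n
    (fun p q hpq hp => by
      rw [hφ, hφ, sq_eq_sq₀ (norm_nonneg _) (norm_nonneg _)] at hpq
      exact hF.mem_of_norm_eq h hpq.symm hp)
    (fun q => ⟨‖q - c‖, by rw [hφ, hφ, add_sub_cancel_left, norm_smul, hn]; simp⟩)
  obtain ⟨p, hp⟩ : S.Nonempty := by
    by_contra hS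
    rw [Set.not_nonempty_iff_eq_empty] at hS
    exact hF.not_subset_plane hpl hn0 0 (by simp [hS])
  have hmem : ∀ q ∈ S, ‖q - c‖ = ‖p - c‖ := by
    intro q hq
    rw [← sq_eq_sq₀ (norm_nonneg _) (norm_nonneg _), ← hφ, ← hφ, hk q hq, hk p hp]
  refine ⟨c, ‖p - c‖, ?_, ?_⟩
  · by_contra h0
    have h0 : ‖p - c‖ = 0 := le_antisymm (not_lt.mp h0) (norm_nonneg _)
    refine hF.not_subset_plane hpl hn0 (inner ℝ n c) fun q hq => ?_
    have := hmem q hq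
    rw [h0, norm_eq_zero, sub_eq_zero] at this
    rw [this]
  · ext q
    rw [mem_sphere_iff_norm]
    exact ⟨hmem q, fun hq => hF.mem_of_norm_eq h hq hp⟩

/-- A surface that is not a plane and has two different axes of revolution is a sphere, and the axes
are not parallel. -/
theorem eq_or_isSphereSet_of_two_axes (hF : IsEquationOf F S) (hpl : ¬ IsPlaneSet S) {a u b v : E3}
    (hu : ‖u‖ = 1) (hv : ‖v‖ = 1) (ha : RevInvariant a u S) (hb : RevInvariant b v S) :
    (cross u v = 0 ∧ ∃ t : ℝ, b = a + t • u) ∨ (cross u v ≠ 0 ∧ IsSphereSet S) := by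
  by_cases huv : cross u v = 0
  · refine Or.inl ⟨huv, inner ℝ u (b - a), ?_⟩
    rw [← eq_inner_smul_of_cross_eq_zero hu, add_sub_cancel]
    have hv2 := eq_inner_smul_of_cross_eq_zero hu huv
    have hb' : RevInvariant b u S := (hv2 ▸ hb).of_smul
    have hu' := coords_sq_of_norm_one hu
    have ht := hF.translation_invariant _ (hF.inner_polyGrad_of_parallel hu ha hb')
    have hperp : inner ℝ u (cross u (b - a)) = 0 := by
      rw [inner_eq_coords]
      simp only [cross_apply_zero, cross_apply_one, cross_apply_two]
      ring
    have h0 := hF.not_translation_invariant hpl ht (ha.cross_translation hu hperp ht)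
    -- For `w = u × (b - a)`, both `w` and `u × w` are translation directions, so their cross
    -- product `‖w‖² u` vanishes. Thus `w = 0`, and `b - a` is parallel to `u`.
    have key : cross (cross u (b - a)) (cross u (cross u (b - a))) =
        (‖cross u (b - a)‖ ^ 2 : ℝ) • u := by
      generalize cross u (b - a) = w at *
      rw [inner_eq_coords] at hperp
      apply E3.ext_coords <;>
        simp only [norm_sq_eq_coords, PiLp.smul_apply, smul_eq_mul, cross_apply_zero,
          cross_apply_one, cross_apply_two]
      · linear_combination -w 0 * hperp
      · linear_combination -w 1 * hperp
      · linear_combination -w 2 * hperp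
    rw [key] at h0
    simpa [E3.ne_zero_of_norm_one hu] using h0
  · refine Or.inr ⟨huv, ?_⟩
    -- Skew axes would give translations along both `u` and `v`. The axes are thus coplanar and not
    -- parallel, so they meet.
    have hT : inner ℝ (cross u v) (b - a) = 0 := by
      by_contra hT
      refine huv (hF.not_translation_invariant hpl
        (hF.translation_invariant u (hF.inner_polyGrad_of_skew hu hv ha hb hT))
        (hF.translation_invariant v (hF.inner_polyGrad_of_skew hv hu hb ha fun h => hT ?_)))
      rw [inner_eq_coords] at h ⊢
      simp only [PiLp.sub_apply, cross_apply_zero, cross_apply_one, cross_apply_two] at h ⊢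
      linear_combination h
    obtain ⟨s, t, hst⟩ := exists_eq_smul_add_smul huv hT
    have hc : b + (-t) • v = a + s • u := by
      rw [← sub_eq_zero, ← sub_eq_zero.mpr hst]; module
    exact hF.isSphereSet_of_tangent hpl fun y p hp =>
      hF.inner_polyGrad_of_concurrent hpl hu hv (ha.of_mem_axis s) (hc ▸ hb.of_mem_axis (-t))
        huv y p hp

end IsEquationOf

/-! ### Rotations, lines and planes in space. -/

theorem finrank_orthogonal_span_singleton_E3 {n : E3} (hn : n ≠ 0) :
    Module.finrank ℝ (Submodule.span ℝ {n})ᗮ = 2 := by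
  have : Fact (Module.finrank ℝ E3 = 2 + 1) := ⟨by simp⟩
  exact Submodule.finrank_orthogonal_span_singleton hn

theorem det_reflection_orthogonal_span_singleton {n : E3} (hn : n ≠ 0) :
    LinearMap.det ((Submodule.span ℝ {n})ᗮ.reflection.toLinearEquiv : E3 →ₗ[ℝ] E3) = -1 := by
  have h := (Submodule.span ℝ {n})ᗮ.det_reflection
  rw [Submodule.orthogonal_orthogonal, finrank_span_singleton hn, pow_one] at h
  exact h

/-- Two points with the same height along a line and the same distance from a point of the line are
exchanged by a rotation about the line. -/
theorem exists_rotation_map_eq {m : AffineSubspace ℝ E3} {a u : E3} (ha : a ∈ m)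
    (hm : m.direction = Submodule.span ℝ {u}) {p q : E3}
    (h1 : inner ℝ u (q - a) = inner ℝ u (p - a)) (h2 : ‖q - a‖ = ‖p - a‖) :
    ∃ g : E3 ≃ᵃⁱ[ℝ] E3, IsRotationAbout m g ∧ g p = q := by
  by_cases hpq : p - a - (q - a) = 0
  · refine ⟨AffineIsometryEquiv.refl ℝ E3, ⟨fun _ _ => rfl, ?_⟩, ?_⟩
    · exact LinearMap.det_id
    · simpa [sub_eq_zero] using hpq
  -- The rotation is a product of two mirrors containing the axis: the first contains `p`, the
  -- second exchanges `p` and `q`.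
  obtain ⟨n, hn, hnu, hnp⟩ := exists_norm_one_orthogonal u (p - a)
  have hn0 := E3.ne_zero_of_norm_one hn
  set K₁ := (Submodule.span ℝ {n})ᗮ with hK₁
  set K₂ := (Submodule.span ℝ {p - a - (q - a)})ᗮ with hK₂
  let L : E3 ≃ₗᵢ[ℝ] E3 := K₁.reflection.trans K₂.reflection
  have hLu : L u = u := by
    have e1 : K₁.reflection u = u := Submodule.reflection_mem_subspace_eq_self
      (Submodule.mem_orthogonal_singleton_iff_inner_right.mpr hnu)
    have e2 : K₂.reflection u = u := Submodule.reflection_mem_subspace_eq_self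
      (Submodule.mem_orthogonal_singleton_iff_inner_left.mpr (by
        rw [inner_sub_right, h1, sub_self]))
    simp [L, e1, e2]
  have hLp : L (p - a) = q - a := by
    have e1 : K₁.reflection (p - a) = p - a := Submodule.reflection_mem_subspace_eq_self
      (Submodule.mem_orthogonal_singleton_iff_inner_right.mpr hnp)
    have e2 : K₂.reflection (p - a) = q - a := Submodule.reflection_sub h2.symm
    simp [L, e1, e2]
  let g : E3 ≃ᵃⁱ[ℝ] E3 := ((AffineIsometryEquiv.vaddConst ℝ a).symm.trans
    L.toAffineIsometryEquiv).trans (AffineIsometryEquiv.vaddConst ℝ a)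
  have hg : ∀ z, g z = L (z - a) + a := fun z => rfl
  refine ⟨g, ⟨fun z hz => ?_, ?_⟩, by rw [hg, hLp, sub_add_cancel]⟩
  · have : z - a ∈ m.direction := AffineSubspace.vsub_mem_direction hz ha
    rw [hm, Submodule.mem_span_singleton] at this
    obtain ⟨t, ht⟩ := this
    rw [hg, ← ht, map_smul, hLu, ht, sub_add_cancel]
  · have : g.linearIsometryEquiv = L := by
      ext1 z
      have := g.map_vsub (z + a) a
      rw [vsub_eq_sub, add_sub_cancel_right] at this
      rw [this, hg, hg]
      simp
    rw [this]
    change LinearMap.det ((K₂.reflection.toLinearEquiv : E3 →ₗ[ℝ] E3) ∘ₗ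
      (K₁.reflection.toLinearEquiv : E3 →ₗ[ℝ] E3)) = 1
    rw [LinearMap.det_comp, det_reflection_orthogonal_span_singleton hn0,
      det_reflection_orthogonal_span_singleton hpq]
    norm_num

theorem IsAxisOfRevolution.revInvariant {S : Set E3} {ℓ : AffineSubspace ℝ E3}
    (h : IsAxisOfRevolution ℓ S) {a u : E3} (ha : a ∈ ℓ)
    (hu : ℓ.direction = Submodule.span ℝ {u}) : RevInvariant a u S := by
  intro p q h1 h2 hp
  obtain ⟨g, hg, rfl⟩ := exists_rotation_map_eq ha hu h1 h2
  rw [← h.2 g hg]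
  exact ⟨p, hp, rfl⟩

theorem IsLine.exists_direction {m : AffineSubspace ℝ E3} (hm : IsLine m) :
    ∃ u : E3, ‖u‖ = 1 ∧ m.direction = Submodule.span ℝ {u} := by
  obtain ⟨v, hv, h⟩ := finrank_eq_one_iff'.mp hm.2
  have hv0 : (v : E3) ≠ 0 := by simpa using hv
  refine ⟨(‖(v : E3)‖⁻¹ : ℝ) • (v : E3), norm_smul_inv_norm hv0, le_antisymm ?_ ?_⟩
  · intro w hw
    obtain ⟨c, hc⟩ := h ⟨w, hw⟩
    rw [Submodule.mem_span_singleton]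
    refine ⟨c * ‖(v : E3)‖, ?_⟩
    rw [smul_smul, mul_assoc, mul_inv_cancel₀ (by simpa using hv0), mul_one]
    exact congrArg Subtype.val hc
  · rw [Submodule.span_singleton_le_iff_mem]
    exact Submodule.smul_mem _ _ v.2

theorem isLine_mk' (o : E3) {w : E3} (hw : w ≠ 0) :
    IsLine (AffineSubspace.mk' o (Submodule.span ℝ {w})) :=
  ⟨⟨o, AffineSubspace.self_mem_mk' _ _⟩, by
    rw [AffineSubspace.direction_mk', finrank_span_singleton hw]⟩

theorem isPlane_mk' (o : E3) {w : E3} (hw : w ≠ 0) :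
    IsPlane (AffineSubspace.mk' o (Submodule.span ℝ {w})ᗮ) :=
  ⟨⟨o, AffineSubspace.self_mem_mk' _ _⟩, by
    rw [AffineSubspace.direction_mk', finrank_orthogonal_span_singleton_E3 hw]⟩

theorem IsPlane.exists_orthonormal {P : AffineSubspace ℝ E3} (hP : IsPlane P) {u : E3}
    (hu : ‖u‖ = 1) (huP : u ∈ P.direction) :
    ∃ w ∈ P.direction, ‖w‖ = 1 ∧ inner ℝ u w = 0 ∧
      ∀ x ∈ P.direction, ∃ s t : ℝ, x = s • u + t • w := by
  have hu0 := E3.ne_zero_of_norm_one hu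
  obtain ⟨x, hxP, hx⟩ : ∃ x ∈ P.direction, x ∉ Submodule.span ℝ {u} := by
    by_contra! h
    have := Submodule.finrank_mono (show P.direction ≤ Submodule.span ℝ {u} from h)
    rw [hP.2, finrank_span_singleton hu0] at this
    omega
  have hy0 : x - (inner ℝ u x : ℝ) • u ≠ 0 := fun h =>
    hx (Submodule.mem_span_singleton.mpr ⟨_, (sub_eq_zero.mp h).symm⟩)
  obtain ⟨y, hy⟩ : ∃ y, y = x - (inner ℝ u x : ℝ) • u := ⟨_, rfl⟩
  have hyP : y ∈ P.direction := hy ▸ P.direction.sub_mem hxP (P.direction.smul_mem _ huP)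
  have huy : inner ℝ u y = 0 := by
    rw [hy, inner_sub_right, inner_smul_right, real_inner_self_eq_norm_sq, hu]; ring
  rw [← hy] at hy0
  obtain ⟨w, hw⟩ : ∃ w, w = (‖y‖⁻¹ : ℝ) • y := ⟨_, rfl⟩
  have hwn : ‖w‖ = 1 := hw ▸ norm_smul_inv_norm hy0
  have huw : inner ℝ u w = 0 := by rw [hw, inner_smul_right, huy, mul_zero]
  have hwP : w ∈ P.direction := hw ▸ P.direction.smul_mem _ hyP
  refine ⟨w, hwP, hwn, huw, ?_⟩
  have hon : Orthonormal ℝ ![u, w] := by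
    rw [orthonormal_vecCons_iff]
    refine ⟨hu, fun i => by fin_cases i; exact huw, ?_⟩
    rw [orthonormal_vecCons_iff]
    exact ⟨hwn, fun i => i.elim0, ⟨fun i => i.elim0, fun i => i.elim0⟩⟩
  have hrange : Set.range ![u, w] = {u, w} := by
    rw [Matrix.range_cons, Matrix.range_cons, Matrix.range_empty, Set.union_empty]; rfl
  have heq : Submodule.span ℝ (Set.range ![u, w]) = P.direction := by
    refine Submodule.eq_of_le_of_finrank_eq ?_ ?_
    · rw [hrange, Submodule.span_le]
      rintro z (rfl | rfl)
      exacts [huP, hwP]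
    · rw [finrank_span_eq_card hon.linearIndependent, hP.2]; rfl
  intro z hz
  rw [← heq, hrange, Submodule.mem_span_pair] at hz
  obtain ⟨s, t, h⟩ := hz
  exact ⟨s, t, h.symm⟩

/-! ### Symmetries reversing the axis, on the surface and on the directrix. -/

/-- The set `S` is invariant under the isometries that reverse the line through `o` in
direction `u`. -/
def RevSymmetric (o u : E3) (S : Set E3) : Prop :=
  ∀ p q : E3, inner ℝ u (q - o) = -inner ℝ u (p - o) → ‖q - o‖ = ‖p - o‖ → p ∈ S → q ∈ S

theorem Function.Involutive.image_eq_iff {α : Type*} {σ : α → α} (hσ : Function.Involutive σ)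
    {X : Set α} : σ '' X = X ↔ ∀ p ∈ X, σ p ∈ X := by
  constructor
  · intro h p hp
    rw [← h]
    exact ⟨p, hp, rfl⟩
  · intro h
    refine Set.Subset.antisymm ?_ fun p hp => ⟨σ p, h p hp, hσ p⟩
    rintro _ ⟨p, hp, rfl⟩
    exact h p hp

/-- An involution reversing an axis of revolution of `S` leaves `S` (or a part `S ∩ T` that meets
all parallels) invariant if and only if all such involutions do. -/
theorem RevInvariant.image_inter_eq_iff {o u : E3} {S T : Set E3} (hS : RevInvariant o u S)
    {σ : E3 → E3} (hσ : Function.Involutive σ)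
    (hinner : ∀ p, inner ℝ u (σ p - o) = -inner ℝ u (p - o)) (hnorm : ∀ p, ‖σ p - o‖ = ‖p - o‖)
    (hσT : ∀ p ∈ T, σ p ∈ T)
    (hT : ∀ p, ∃ p' ∈ T, inner ℝ u (p' - o) = inner ℝ u (p - o) ∧ ‖p' - o‖ = ‖p - o‖) :
    σ '' (S ∩ T) = S ∩ T ↔ RevSymmetric o u S := by
  rw [hσ.image_eq_iff]
  constructor
  · intro h p q h1 h2 hp
    obtain ⟨p', hp'T, e1, e2⟩ := hT p
    refine hS (σ p') q ?_ ?_ (h p' ⟨hS p p' e1 e2 hp, hp'T⟩).1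
    · rw [hinner, e1, h1]
    · rw [hnorm, e2, h2]
  · intro h p hp
    exact ⟨h p _ (hinner p) (hnorm p) hp.1, hσT p hp.2⟩

theorem RevInvariant.image_eq_iff {o u : E3} {S : Set E3} (hS : RevInvariant o u S)
    {σ : E3 → E3} (hσ : Function.Involutive σ)
    (hinner : ∀ p, inner ℝ u (σ p - o) = -inner ℝ u (p - o)) (hnorm : ∀ p, ‖σ p - o‖ = ‖p - o‖) :
    σ '' S = S ↔ RevSymmetric o u S := by
  simpa using hS.image_inter_eq_iff (T := Set.univ) hσ hinner hnorm (fun _ _ => trivial)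
    (fun p => ⟨p, trivial, rfl, rfl⟩)

/-- A plane containing the axis meets all parallels. -/
theorem exists_mem_plane_same_profile {P : AffineSubspace ℝ E3} (hP : IsPlane P) {o u : E3}
    (hu : ‖u‖ = 1) (ho : o ∈ P) (huP : u ∈ P.direction) (p : E3) :
    ∃ p' ∈ P, inner ℝ u (p' - o) = inner ℝ u (p - o) ∧ ‖p' - o‖ = ‖p - o‖ := by
  obtain ⟨w, hwP, hw, huw, -⟩ := hP.exists_orthonormal hu huP
  obtain ⟨x, hx⟩ : ∃ x, x = p - o := ⟨_, rfl⟩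
  have hle : (inner ℝ u x : ℝ) ^ 2 ≤ ‖x‖ ^ 2 := by
    have := abs_real_inner_le_norm u x
    rw [hu, one_mul] at this
    exact sq_le_sq.mpr (by rwa [abs_norm])
  -- The point of the plane with the height of `p`, at the distance of `p` from the axis, given by
  -- Pythagoras.
  refine ⟨o + ((inner ℝ u x : ℝ) • u + √(‖x‖ ^ 2 - (inner ℝ u x : ℝ) ^ 2) • w), ?_, ?_, ?_⟩
  · rw [add_comm]
    exact AffineSubspace.vadd_mem_of_mem_direction
      (P.direction.add_mem (P.direction.smul_mem _ huP) (P.direction.smul_mem _ hwP)) ho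
  · rw [add_sub_cancel_left, inner_add_right, inner_smul_right, inner_smul_right, huw,
      real_inner_self_eq_norm_sq, hu, hx]
    ring
  · rw [add_sub_cancel_left, ← hx, ← sq_eq_sq₀ (norm_nonneg _) (norm_nonneg _), norm_add_sq_real,
      inner_smul_left, inner_smul_right, huw, norm_smul, norm_smul, hu, hw, mul_one, mul_one,
      Real.norm_eq_abs, Real.norm_eq_abs, sq_abs, sq_abs, Real.sq_sqrt (by linarith)]
    ring

section Reflection

variable {A : AffineSubspace ℝ E3} [Nonempty A]

theorem reflection_sub_of_mem {o : E3} (ho : o ∈ A) (p : E3) :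
    EuclideanGeometry.reflection A p - o = A.direction.reflection (p - o) := by
  rw [EuclideanGeometry.reflection_apply_of_mem A p ho]
  simp

theorem inner_reflection_right (K : Submodule ℝ E3) (u x : E3) :
    inner ℝ u (K.reflection x) = inner ℝ (K.reflection u) x := by
  rw [← LinearIsometryEquiv.inner_map_map K.reflection u, Submodule.reflection_reflection]

theorem reflection_eq_neg_iff (K : Submodule ℝ E3) (u : E3) :
    K.reflection u = -u ↔ u ∈ Kᗮ := by
  rw [← Submodule.reflection_eq_self_iff (K := Kᗮ), Submodule.reflection_orthogonal_apply,
    neg_eq_iff_eq_neg]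

theorem norm_reflection_sub_of_mem {o : E3} (ho : o ∈ A) (p : E3) :
    ‖EuclideanGeometry.reflection A p - o‖ = ‖p - o‖ := by
  rw [reflection_sub_of_mem ho, LinearIsometryEquiv.norm_map]

theorem inner_reflection_sub_of_orthogonal {o u : E3} (ho : o ∈ A) (hu : u ∈ A.directionᗮ) (p : E3) :
    inner ℝ u (EuclideanGeometry.reflection A p - o) = -inner ℝ u (p - o) := by
  rw [reflection_sub_of_mem ho, inner_reflection_right, (reflection_eq_neg_iff _ _).mpr hu,
    inner_neg_left]

end Reflection

/-- The dimension of `A` plays no role: lines and planes normal to the axis at `o` give the same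
condition. -/
theorem isSymmetricAbout_iff_revSymmetric {A : AffineSubspace ℝ E3} {o u : E3} {S : Set E3}
    (hS : RevInvariant o u S) (ho : o ∈ A) (hA : u ∈ A.directionᗮ) :
    IsSymmetricAbout A S ↔ RevSymmetric o u S := by
  have : Nonempty A := ⟨⟨o, ho⟩⟩
  rw [← hS.image_eq_iff (EuclideanGeometry.reflection_involutive A)
    (inner_reflection_sub_of_orthogonal ho hA) (norm_reflection_sub_of_mem ho)]
  exact ⟨fun ⟨_, h⟩ => h, fun h => ⟨this, h⟩⟩

/-- The plane `P` meets every parallel circle, so nothing is lost by restricting to the directrix.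
-/
theorem isSymmetricAbout_directrix_iff_revSymmetric {A P : AffineSubspace ℝ E3} (hP : IsPlane P)
    {o u : E3} (hu : ‖u‖ = 1) (huP : u ∈ P.direction) {S : Set E3}
    (hS : RevInvariant o u S) (ho : o ∈ A) (hA : u ∈ A.directionᗮ) (hAP : A ≤ P) :
    IsSymmetricAbout A (directrix S P) ↔ RevSymmetric o u S := by
  have : Nonempty A := ⟨⟨o, ho⟩⟩
  rw [← hS.image_inter_eq_iff (T := (P : Set E3)) (EuclideanGeometry.reflection_involutive A)
    (inner_reflection_sub_of_orthogonal ho hA) (norm_reflection_sub_of_mem ho)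
    (fun p hp => EuclideanGeometry.reflection_mem_of_le_of_mem hAP hp)
    (exists_mem_plane_same_profile hP hu (hAP ho) huP)]
  exact ⟨fun ⟨_, h⟩ => h, fun h => ⟨this, h⟩⟩

/-- Such a reflection fixes `u` and `o`, hence keeps height and distance. -/
theorem isSymmetricAbout_of_mem_direction {A : AffineSubspace ℝ E3} {o u : E3} {S : Set E3}
    (hS : RevInvariant o u S) (ho : o ∈ A) (hA : u ∈ A.direction) : IsSymmetricAbout A S := by
  have : Nonempty A := ⟨⟨o, ho⟩⟩
  refine ⟨this, ((EuclideanGeometry.reflection_involutive A).image_eq_iff).mpr fun p hp =>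
    hS p _ ?_ (norm_reflection_sub_of_mem ho p) hp⟩
  rw [reflection_sub_of_mem ho, inner_reflection_right,
    Submodule.reflection_mem_subspace_eq_self hA]

theorem isSymmetryCenter_iff_revSymmetric {o u : E3} {S : Set E3} (hS : RevInvariant o u S) :
    IsSymmetryCenter o S ↔ RevSymmetric o u S :=
  hS.image_eq_iff (Equiv.pointReflection_involutive o)
    (fun p => by
      rw [Equiv.pointReflection_apply, vsub_eq_sub, vadd_eq_add, add_sub_cancel_right, ← neg_sub,
        inner_neg_right])
    (fun p => by
      rw [Equiv.pointReflection_apply, vsub_eq_sub, vadd_eq_add, add_sub_cancel_right,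
        norm_sub_rev])

theorem isSymmetryCenter_directrix_iff_revSymmetric {P : AffineSubspace ℝ E3} (hP : IsPlane P)
    {o u : E3} (hu : ‖u‖ = 1) (ho : o ∈ P) (huP : u ∈ P.direction) {S : Set E3}
    (hS : RevInvariant o u S) : IsSymmetryCenter o (directrix S P) ↔ RevSymmetric o u S :=
  hS.image_inter_eq_iff (Equiv.pointReflection_involutive o)
    (fun p => by
      rw [Equiv.pointReflection_apply, vsub_eq_sub, vadd_eq_add, add_sub_cancel_right, ← neg_sub,
        inner_neg_right])
    (fun p => by
      rw [Equiv.pointReflection_apply, vsub_eq_sub, vadd_eq_add, add_sub_cancel_right,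
        norm_sub_rev])
    (fun _ hp => AffineSubspace.vadd_mem_of_mem_direction
      (AffineSubspace.vsub_mem_direction ho hp) ho)
    (exists_mem_plane_same_profile hP hu ho huP)

theorem norm_one_smul_eq_or_eq_neg {u : E3} {s : ℝ} (hu : ‖u‖ = 1) (h : ‖s • u‖ = 1) :
    s • u = u ∨ s • u = -u := by
  rw [norm_smul, hu, mul_one, Real.norm_eq_abs] at h
  rcases eq_or_eq_neg_of_abs_eq h with rfl | rfl <;> simp

theorem IsLine.eq_of_le {m m' : AffineSubspace ℝ E3} (hm : IsLine m) (hm' : IsLine m')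
    (hle : m ≤ m') : m = m' :=
  AffineSubspace.eq_of_direction_eq_of_nonempty_of_le
    (Submodule.eq_of_le_of_finrank_eq (AffineSubspace.direction_le hle) (hm.2.trans hm'.2.symm))
    hm.1 hle

/-! ### Position of the symmetries relative to the axis. -/

/-- The data of a surface of revolution, not a plane, with axis `ℓ` of unit direction `u`. -/
structure IsRevolutionSurface (F : MvPolynomial (Fin 3) ℝ) (S : Set E3) (ℓ : AffineSubspace ℝ E3)
    (u : E3) : Prop where
  equation : IsEquationOf F S
  not_plane : ¬ IsPlaneSet S
  isLine : IsLine ℓ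
  norm_eq : ‖u‖ = 1
  direction_eq : ℓ.direction = Submodule.span ℝ {u}
  rev : ∀ o ∈ ℓ, RevInvariant o u S

namespace IsRevolutionSurface

variable {F : MvPolynomial (Fin 3) ℝ} {S : Set E3} {ℓ : AffineSubspace ℝ E3} {u : E3}

theorem dir_mem (h : IsRevolutionSurface F S ℓ u) : u ∈ ℓ.direction :=
  h.direction_eq ▸ Submodule.mem_span_singleton_self u

theorem add_smul_mem (h : IsRevolutionSurface F S ℓ u) {a : E3} (ha : a ∈ ℓ) (t : ℝ) :
    a + t • u ∈ ℓ := by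
  rw [add_comm]
  exact AffineSubspace.vadd_mem_of_mem_direction (ℓ.direction.smul_mem _ h.dir_mem) ha

theorem isNormalTo_iff (h : IsRevolutionSurface F S ℓ u) (A : AffineSubspace ℝ E3) :
    IsNormalTo A ℓ ↔ u ∈ A.directionᗮ := by
  rw [IsNormalTo, Submodule.isOrtho_comm, Submodule.isOrtho_iff_le, h.direction_eq,
    Submodule.span_singleton_le_iff_mem]

theorem le_of_mem (h : IsRevolutionSurface F S ℓ u) {A : AffineSubspace ℝ E3} {o : E3}
    (ho : o ∈ ℓ) (hoA : o ∈ A) (hu : u ∈ A.direction) : ℓ ≤ A := by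
  intro p hp
  have h1 : p - o ∈ ℓ.direction := AffineSubspace.vsub_mem_direction hp ho
  rw [h.direction_eq] at h1
  have h2 : p - o ∈ A.direction := (Submodule.span_singleton_le_iff_mem _ _).mpr hu h1
  rw [← sub_add_cancel p o]
  exact AffineSubspace.vadd_mem_of_mem_direction h2 hoA

theorem eq_of_mem (h : IsRevolutionSurface F S ℓ u) {m : AffineSubspace ℝ E3} (hm : IsLine m)
    {o : E3} (ho : o ∈ ℓ) (hom : o ∈ m) (hu : u ∈ m.direction) : m = ℓ := 
  (h.isLine.eq_of_le hm (h.le_of_mem ho hom hu)).symm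

theorem exists_plane (h : IsRevolutionSurface F S ℓ u) {m : AffineSubspace ℝ E3} (hm : IsLine m)
    {o : E3} (ho : o ∈ ℓ) (hom : o ∈ m) : ∃ R : AffineSubspace ℝ E3, IsPlane R ∧ ℓ ≤ R ∧ m ≤ R := by
  obtain ⟨w, -, hw⟩ := hm.exists_direction
  obtain ⟨n, hn, hnu, hnw⟩ := exists_norm_one_orthogonal u w
  refine ⟨AffineSubspace.mk' o (Submodule.span ℝ {n})ᗮ,
    isPlane_mk' o (E3.ne_zero_of_norm_one hn),
    h.le_of_mem ho (AffineSubspace.self_mem_mk' _ _) ?_, fun p hp => ?_⟩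
  · rwa [AffineSubspace.direction_mk', Submodule.mem_orthogonal_singleton_iff_inner_right]
  · rw [AffineSubspace.mem_mk', Submodule.mem_orthogonal_singleton_iff_inner_right]
    have : p -ᵥ o ∈ m.direction := AffineSubspace.vsub_mem_direction hp hom
    rw [hw, Submodule.mem_span_singleton] at this
    obtain ⟨t, ht⟩ := this
    rw [← ht, inner_smul_right, hnw, mul_zero]

/-- If the reflection in `A` leaves `S` invariant and `S` is not a sphere, then `A` meets the axis of
revolution and is parallel or normal to it. -/
theorem exists_mem_of_isSymmetricAbout (h : IsRevolutionSurface F S ℓ u) (hsph : ¬ IsSphereSet S)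
    {A : AffineSubspace ℝ E3} (hA : IsSymmetricAbout A S) :
    ∃ o ∈ ℓ, o ∈ A ∧ (u ∈ A.direction ∨ u ∈ A.directionᗮ) := by
  obtain ⟨hne, hA⟩ := hA
  obtain ⟨a, ha⟩ := h.isLine.1
  set σ := EuclideanGeometry.reflection A with hσ
  have hinv := EuclideanGeometry.reflection_involutive A
  obtain ⟨x, hx⟩ := id hne
  have hsub : ∀ p q, σ p - σ q = A.direction.reflection (p - q) := by
    intro p q
    rw [← sub_sub_sub_cancel_right _ _ x, reflection_sub_of_mem hx, reflection_sub_of_mem hx,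
      ← map_sub, sub_sub_sub_cancel_right]
  -- The image of the axis under the reflection is again an axis of revolution, so it is `ℓ` itself.
  have hc : RevInvariant (σ a) (A.direction.reflection u) S := by
    refine (h.rev a ha).conj σ hinv (hinv.image_eq_iff.mp hA) (fun p => ?_) (fun p => ?_)
    · rw [← inner_reflection_right, ← hsub, hinv a]
    · rw [← LinearIsometryEquiv.norm_map A.direction.reflection, ← hsub, hinv p]
  rcases h.equation.eq_or_isSphereSet_of_two_axes h.not_plane h.norm_eq
    (by rw [LinearIsometryEquiv.norm_map, h.norm_eq]) (h.rev a ha) hc with ⟨hcr, t, ht⟩ | ⟨-, hs⟩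
  · refine ⟨a + (t / 2) • u, h.add_smul_mem ha _, ?_, ?_⟩
    -- The midpoint of `a` and `σ a` is fixed by `σ`, hence lies in `A`, and it lies on `ℓ`.
    · have hmid : midpoint ℝ a (σ a) = a + (t / 2) • u := by
        rw [ht, midpoint_eq_smul_add, ← sub_eq_zero]
        simp only [invOf_eq_inv]
        module
      rw [← hmid, ← EuclideanGeometry.reflection_eq_self_iff, ← hσ]
      have := σ.toAffineEquiv.map_midpoint a (σ a)
      rw [AffineIsometryEquiv.coe_toAffineEquiv, hinv a] at this
      rw [this, midpoint_comm]
    · have hs := eq_inner_smul_of_cross_eq_zero h.norm_eq hcr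
      have hn : ‖A.direction.reflection u‖ = 1 := by rw [LinearIsometryEquiv.norm_map, h.norm_eq]
      rw [hs] at hn
      rcases norm_one_smul_eq_or_eq_neg h.norm_eq hn with e | e <;> rw [e] at hs
      · exact Or.inl ((Submodule.reflection_eq_self_iff _).mp hs)
      · exact Or.inr ((reflection_eq_neg_iff _ _).mp hs)
  · exact absurd hs hsph

/-- The point reflection carries `ℓ` to a parallel axis of revolution. Parallel axes coincide on a
sphere too, so `ℓ` is preserved and contains `c`. -/
theorem mem_of_isSymmetryCenter (h : IsRevolutionSurface F S ℓ u) {c : E3}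
    (hc : IsSymmetryCenter c S) : c ∈ ℓ := by
  obtain ⟨a, ha⟩ := h.isLine.1
  have hinv := Equiv.pointReflection_involutive c
  have happ : ∀ p, Equiv.pointReflection c p = c - p + c := fun p => rfl
  have hrev : RevInvariant (Equiv.pointReflection c a) (-u) S := by
    refine (h.rev a ha).conj _ hinv (hinv.image_eq_iff.mp hc) (fun p => ?_) (fun p => ?_)
    · rw [happ, happ, inner_neg_left, ← inner_neg_right]
      congr 1
      abel
    · rw [happ, happ, ← norm_neg]
      congr 1
      abel
  have hcr : cross u (-u) = 0 := by
    apply E3.ext_coords <;> simp [mul_comm]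
  rcases h.equation.eq_or_isSphereSet_of_two_axes h.not_plane h.norm_eq
    (by rw [norm_neg, h.norm_eq]) (h.rev a ha) hrev with ⟨-, t, ht⟩ | ⟨hne, -⟩
  · have : c = a + (t / 2) • u := by
      rw [happ] at ht
      have h2 : (2 : ℝ) • c = (2 : ℝ) • (a + (t / 2) • u) := by
        rw [← sub_eq_zero] at ht ⊢
        rw [← ht]
        module
      exact smul_right_injective E3 (two_ne_zero' ℝ) h2
    rw [this]
    exact h.add_smul_mem ha _
  · exact absurd hcr hne

theorem isSymmetryAxis_iff (h : IsRevolutionSurface F S ℓ u) (hsph : ¬ IsSphereSet S)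
    {m : AffineSubspace ℝ E3} (hm : IsLine m) (hne : m ≠ ℓ) :
    IsSymmetryAxis m S ↔ ∃ o ∈ ℓ, o ∈ m ∧ u ∈ m.directionᗮ ∧ RevSymmetric o u S := by
  constructor
  · rintro ⟨-, hs⟩
    obtain ⟨o, ho, hom, hu | hu⟩ := h.exists_mem_of_isSymmetricAbout hsph hs
    · exact absurd (h.eq_of_mem hm ho hom hu) hne
    · exact ⟨o, ho, hom, hu, (isSymmetricAbout_iff_revSymmetric (h.rev o ho) hom hu).mp hs⟩
  · rintro ⟨o, ho, hom, hu, hs⟩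
    exact ⟨hm, (isSymmetricAbout_iff_revSymmetric (h.rev o ho) hom hu).mpr hs⟩

theorem isSymmetryPlane_iff (h : IsRevolutionSurface F S ℓ u) (hsph : ¬ IsSphereSet S)
    {Q : AffineSubspace ℝ E3} (hQ : IsPlane Q) (hne : ¬ ℓ ≤ Q) :
    IsSymmetryPlane Q S ↔ ∃ o ∈ ℓ, o ∈ Q ∧ u ∈ Q.directionᗮ ∧ RevSymmetric o u S := by
  constructor
  · rintro ⟨-, hs⟩
    obtain ⟨o, ho, hoQ, hu | hu⟩ := h.exists_mem_of_isSymmetricAbout hsph hs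
    · exact absurd (h.le_of_mem ho hoQ hu) hne
    · exact ⟨o, ho, hoQ, hu, (isSymmetricAbout_iff_revSymmetric (h.rev o ho) hoQ hu).mp hs⟩
  · rintro ⟨o, ho, hoQ, hu, hs⟩
    exact ⟨hQ, (isSymmetricAbout_iff_revSymmetric (h.rev o ho) hoQ hu).mpr hs⟩

theorem dir_not_mem_orthogonal (h : IsRevolutionSurface F S ℓ u) {K : Submodule ℝ E3}
    (hK : u ∈ K) : u ∉ Kᗮ := by
  intro hu
  have := (Submodule.mem_orthogonal _ _).mp hu u hK
  rw [inner_self_eq_zero] at this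
  exact E3.ne_zero_of_norm_one h.norm_eq this

theorem not_le_of_orthogonal (h : IsRevolutionSurface F S ℓ u) {A : AffineSubspace ℝ E3}
    (hA : u ∈ A.directionᗮ) : ¬ ℓ ≤ A := fun hle =>
  h.dir_not_mem_orthogonal (AffineSubspace.direction_le hle h.dir_mem) hA

theorem ne_of_orthogonal (h : IsRevolutionSurface F S ℓ u) {A : AffineSubspace ℝ E3}
    (hA : u ∈ A.directionᗮ) : A ≠ ℓ := fun e => h.not_le_of_orthogonal hA e.ge

theorem isSymmetryAxis_self (h : IsRevolutionSurface F S ℓ u) : IsSymmetryAxis ℓ S := by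
  obtain ⟨a, ha⟩ := h.isLine.1
  exact ⟨h.isLine, isSymmetricAbout_of_mem_direction (h.rev a ha) ha h.dir_mem⟩

theorem isSymmetryPlane_of_le (h : IsRevolutionSurface F S ℓ u) {Q : AffineSubspace ℝ E3}
    (hQ : IsPlane Q) (hle : ℓ ≤ Q) : IsSymmetryPlane Q S := by
  obtain ⟨a, ha⟩ := h.isLine.1
  exact ⟨hQ, isSymmetricAbout_of_mem_direction (h.rev a ha) (hle ha)
    (AffineSubspace.direction_le hle h.dir_mem)⟩

/-- The directions of a plane normal to the axis are all the directions orthogonal to it. -/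
theorem direction_eq_of_orthogonal (h : IsRevolutionSurface F S ℓ u) {Q : AffineSubspace ℝ E3}
    (hQ : IsPlane Q) (hu : u ∈ Q.directionᗮ) : Q.direction = (Submodule.span ℝ {u})ᗮ := by
  refine Submodule.eq_of_le_of_finrank_eq ?_ ?_
  · intro x hx
    rw [Submodule.mem_orthogonal_singleton_iff_inner_left]
    exact (Submodule.mem_orthogonal _ _).mp hu x hx
  · rw [hQ.2, finrank_orthogonal_span_singleton_E3 (E3.ne_zero_of_norm_one h.norm_eq)]

theorem exists_mem_of_normal_plane (h : IsRevolutionSurface F S ℓ u) {Q : AffineSubspace ℝ E3}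
    (hQ : IsPlane Q) (hu : u ∈ Q.directionᗮ) : ∃ o ∈ ℓ, o ∈ Q := by
  obtain ⟨a, ha⟩ := h.isLine.1
  obtain ⟨b, hb⟩ := hQ.1
  refine ⟨a + (inner ℝ u (b - a) : ℝ) • u, h.add_smul_mem ha _, ?_⟩
  rw [← AffineSubspace.vsub_right_mem_direction_iff_mem hb, h.direction_eq_of_orthogonal hQ hu,
    Submodule.mem_orthogonal_singleton_iff_inner_right, vsub_eq_sub, add_sub_right_comm,
    inner_add_right, inner_smul_right, real_inner_self_eq_norm_sq, h.norm_eq, ← neg_sub b a,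
    inner_neg_right]
  ring

/-- Perpendicular lines of one plane meet; in space they could be skew. -/
theorem exists_mem_of_normal_line (h : IsRevolutionSurface F S ℓ u) {P m : AffineSubspace ℝ E3}
    (hP : IsPlane P) (hℓP : ℓ ≤ P) (hm : IsLine m) (hmP : m ≤ P) (hu : u ∈ m.directionᗮ) :
    ∃ o ∈ ℓ, o ∈ m := by
  obtain ⟨a, ha⟩ := h.isLine.1
  obtain ⟨b, hb⟩ := hm.1
  obtain ⟨w, -, -, huw, hspan⟩ := hP.exists_orthonormal h.norm_eq
    (AffineSubspace.direction_le hℓP h.dir_mem)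
  obtain ⟨d, hd, hmd⟩ := hm.exists_direction
  have hdm : d ∈ m.direction := hmd ▸ Submodule.mem_span_singleton_self d
  obtain ⟨s, t, hst⟩ := hspan d (AffineSubspace.direction_le hmP hdm)
  have hs : s = 0 := by
    have := (Submodule.mem_orthogonal' _ _).mp hu d hdm
    rw [hst, inner_add_right, inner_smul_right, inner_smul_right, huw, real_inner_self_eq_norm_sq,
      h.norm_eq] at this
    linarith
  rw [hs, zero_smul, zero_add] at hst
  have ht : t ≠ 0 := by
    rintro rfl
    rw [zero_smul] at hst
    exact E3.ne_zero_of_norm_one hd hst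
  have hwm : w ∈ m.direction := by
    have : w = t⁻¹ • d := by rw [hst, smul_smul, inv_mul_cancel₀ ht, one_smul]
    exact this ▸ m.direction.smul_mem _ hdm
  obtain ⟨s', t', hst'⟩ := hspan (b - a)
    (AffineSubspace.vsub_mem_direction (hmP hb) (hℓP ha))
  refine ⟨a + s' • u, h.add_smul_mem ha _, ?_⟩
  have : a + s' • u = -(t' • w) + b := by
    rw [← sub_eq_zero] at hst'
    rw [← sub_eq_zero, ← neg_eq_zero, ← hst']
    abel
  rw [this]
  exact AffineSubspace.vadd_mem_of_mem_direction
    (m.direction.neg_mem (m.direction.smul_mem _ hwm)) hb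

theorem isLine_inf (h : IsRevolutionSurface F S ℓ u) {R Q : AffineSubspace ℝ E3}
    (hR : IsPlane R) (hℓR : ℓ ≤ R) (hQ : IsPlane Q) (hu : u ∈ Q.directionᗮ) : IsLine (R ⊓ Q) := by
  obtain ⟨o, ho, hoQ⟩ := h.exists_mem_of_normal_plane hQ hu
  refine ⟨⟨o, hℓR ho, hoQ⟩, ?_⟩
  rw [AffineSubspace.direction_inf_of_mem (hℓR ho) hoQ, h.direction_eq_of_orthogonal hQ hu]
  obtain ⟨w, hwR, hw, huw, hspan⟩ := hR.exists_orthonormal h.norm_eq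
    (AffineSubspace.direction_le hℓR h.dir_mem)
  have : R.direction ⊓ (Submodule.span ℝ {u})ᗮ = Submodule.span ℝ {w} := by
    refine le_antisymm ?_ ?_
    · rintro x ⟨hxR, hx⟩
      obtain ⟨s, t, hst⟩ := hspan x hxR
      rw [SetLike.mem_coe, Submodule.mem_orthogonal_singleton_iff_inner_right, hst, inner_add_right,
        inner_smul_right, inner_smul_right, huw, real_inner_self_eq_norm_sq, h.norm_eq] at hx
      have hs : s = 0 := by linarith
      rw [hst, hs, zero_smul, zero_add]
      exact Submodule.smul_mem _ _ (Submodule.mem_span_singleton_self w)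
    · rw [Submodule.span_singleton_le_iff_mem]
      exact ⟨hwR, Submodule.mem_orthogonal_singleton_iff_inner_right.mpr huw⟩
  rw [this, finrank_span_singleton (E3.ne_zero_of_norm_one hw)]

theorem orthogonal_inf (Q R : AffineSubspace ℝ E3) {o : E3} (hoR : o ∈ R) (hoQ : o ∈ Q)
    (hu : u ∈ Q.directionᗮ) : u ∈ (R ⊓ Q).directionᗮ := by
  rw [AffineSubspace.direction_inf_of_mem hoR hoQ]
  exact Submodule.orthogonal_le inf_le_right hu

theorem isPlanarSymmetryAxis_iff (h : IsRevolutionSurface F S ℓ u) {P m : AffineSubspace ℝ E3}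
    (hP : IsPlane P) (hℓP : ℓ ≤ P) (hm : IsLine m) (hmP : m ≤ P) {o : E3} (ho : o ∈ ℓ) (hom : o ∈ m)
    (hu : u ∈ m.directionᗮ) :
    IsPlanarSymmetryAxis P m (directrix S P) ↔ RevSymmetric o u S := by
  rw [← isSymmetricAbout_directrix_iff_revSymmetric hP h.norm_eq
    (AffineSubspace.direction_le hℓP h.dir_mem) (h.rev o ho) hom hu hmP]
  exact ⟨fun h => h.2.2, fun h => ⟨hm, hmP, h⟩⟩

/-- The plane through `o` normal to the axis. -/
theorem normalPlane_spec (h : IsRevolutionSurface F S ℓ u) (o : E3) :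
    IsPlane (AffineSubspace.mk' o (Submodule.span ℝ {u})ᗮ) ∧
      o ∈ AffineSubspace.mk' o (Submodule.span ℝ {u})ᗮ ∧
      u ∈ (AffineSubspace.mk' o (Submodule.span ℝ {u})ᗮ).directionᗮ := by
  refine ⟨isPlane_mk' o (E3.ne_zero_of_norm_one h.norm_eq), AffineSubspace.self_mem_mk' _ _, ?_⟩
  rw [AffineSubspace.direction_mk', Submodule.orthogonal_orthogonal]
  exact Submodule.mem_span_singleton_self u

theorem le_normalPlane {m : AffineSubspace ℝ E3} {o : E3} (hom : o ∈ m) (hu : u ∈ m.directionᗮ) :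
    m ≤ AffineSubspace.mk' o (Submodule.span ℝ {u})ᗮ := by
  intro p hp
  rw [AffineSubspace.mem_mk', Submodule.mem_orthogonal_singleton_iff_inner_left]
  exact (Submodule.mem_orthogonal _ _).mp hu _ (AffineSubspace.vsub_mem_direction hp hom)

/-- The line is cut out of `P` by the plane normal to the axis at `o`. -/
theorem exists_planarSymmetryAxis (h : IsRevolutionSurface F S ℓ u) {P : AffineSubspace ℝ E3}
    (hP : IsPlane P) (hℓP : ℓ ≤ P) {o : E3} (ho : o ∈ ℓ) (hs : RevSymmetric o u S) :
    ∃ m₀, IsPlanarSymmetryAxis P m₀ (directrix S P) ∧ u ∈ m₀.directionᗮ ∧ o ∈ m₀ := by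
  obtain ⟨hQ, hoQ, hu⟩ := h.normalPlane_spec o
  have hu' := orthogonal_inf _ P (hℓP ho) hoQ hu
  exact ⟨_, (h.isPlanarSymmetryAxis_iff hP hℓP (h.isLine_inf hP hℓP hQ hu) inf_le_left ho
    ⟨hℓP ho, hoQ⟩ hu').mpr hs, hu', hℓP ho, hoQ⟩

/-- Any two lines normal to the axis at the same point differ by a rotation about the axis. -/
theorem exists_rotation_map_line (h : IsRevolutionSurface F S ℓ u) {m₀ m : AffineSubspace ℝ E3}
    (hm₀ : IsLine m₀) (hm : IsLine m) {o : E3} (ho : o ∈ ℓ) (ho₀ : o ∈ m₀) (hom : o ∈ m)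
    (hu₀ : u ∈ m₀.directionᗮ) (hu : u ∈ m.directionᗮ) :
    ∃ g : E3 ≃ᵃⁱ[ℝ] E3, IsRotationAbout ℓ g ∧ m = m₀.map (g.toAffineEquiv : E3 →ᵃ[ℝ] E3) := by
  obtain ⟨w₀, hw₀, hd₀⟩ := hm₀.exists_direction
  obtain ⟨w, hw, hd⟩ := hm.exists_direction
  have e₀ : inner ℝ u w₀ = 0 := (Submodule.mem_orthogonal' _ _).mp hu₀ w₀
    (hd₀ ▸ Submodule.mem_span_singleton_self w₀)
  have e : inner ℝ u w = 0 := (Submodule.mem_orthogonal' _ _).mp hu w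
    (hd ▸ Submodule.mem_span_singleton_self w)
  -- Both points have height zero and distance one from `o`, so a rotation about `ℓ` takes one to
  -- the other.
  obtain ⟨g, hg, hgw⟩ := exists_rotation_map_eq (p := o + w₀) (q := o + w) ho h.direction_eq
    (by simp [e₀, e]) (by simp [hw₀, hw])
  refine ⟨g, hg, ?_⟩
  have hlin : g.linearIsometryEquiv w₀ = w := by
    have := g.map_vsub (o + w₀) o
    simpa [hgw, hg.1 o ho] using this
  refine AffineSubspace.ext_of_direction_eq ?_ ⟨o, hom, o, ho₀, hg.1 o ho⟩
  rw [AffineSubspace.map_direction, hd₀, hd, Submodule.map_span, Set.image_singleton]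
  exact congrArg (fun x => Submodule.span ℝ {x}) hlin.symm

theorem infinite_symmetryAxes (h : IsRevolutionSurface F S ℓ u) {o : E3} (ho : o ∈ ℓ)
    (hs : RevSymmetric o u S) : {m : AffineSubspace ℝ E3 | IsSymmetryAxis m S}.Infinite := by
  obtain ⟨w, hw, hwu, -⟩ := exists_norm_one_orthogonal u 0
  obtain ⟨z, hz, hzu, hzw⟩ := exists_norm_one_orthogonal u w
  rw [real_inner_comm] at hwu hzu
  have hwt : ∀ t : ℝ, inner ℝ w (w + t • z) = 1 := by
    intro t
    rw [inner_add_right, inner_smul_right, real_inner_comm z w, hzw,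
      real_inner_self_eq_norm_sq, hw]
    ring
  have hne : ∀ t : ℝ, w + t • z ≠ 0 := by
    intro t h0
    have := hwt t
    rw [h0, inner_zero_right] at this
    exact zero_ne_one this
  -- The directions `w + t • z` all pair to `1` with `w`, so two proportional ones are equal.
  refine Set.infinite_of_injective_forall_mem
    (f := fun t : ℝ => AffineSubspace.mk' o (Submodule.span ℝ {w + t • z})) ?_ ?_
  · intro t t' htt
    have hd := congrArg AffineSubspace.direction htt
    simp only [AffineSubspace.direction_mk'] at hd
    have hmem : w + t • z ∈ Submodule.span ℝ {w + t' • z} :=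
      hd ▸ Submodule.mem_span_singleton_self _
    obtain ⟨c, hc⟩ := Submodule.mem_span_singleton.mp hmem
    have h1 := congrArg (fun x => (inner ℝ w x : ℝ)) hc
    simp only [inner_smul_right, hwt, mul_one] at h1
    rw [h1, one_smul, add_right_inj] at hc
    exact (smul_left_injective ℝ (E3.ne_zero_of_norm_one hz) hc).symm
  · intro t
    refine ⟨isLine_mk' o (hne t), (isSymmetricAbout_iff_revSymmetric (h.rev o ho)
      (AffineSubspace.self_mem_mk' _ _) ?_).mpr hs⟩
    rw [AffineSubspace.direction_mk', Submodule.mem_orthogonal_singleton_iff_inner_left,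
      inner_add_right, inner_smul_right, hwu, hzu]
    ring

/-- Two different centers of symmetry on the axis make the surface a cylinder. -/
theorem isCylindrical_of_ne (h : IsRevolutionSurface F S ℓ u) {o o' : E3} (ho : o ∈ ℓ)
    (ho' : o' ∈ ℓ) (hs : RevSymmetric o u S) (hs' : RevSymmetric o' u S) (hne : o ≠ o') :
    IsCylindrical S := by
  rw [← isSymmetryCenter_iff_revSymmetric (h.rev o ho), IsSymmetryCenter,
    (Equiv.pointReflection_involutive o).image_eq_iff] at hs
  rw [← isSymmetryCenter_iff_revSymmetric (h.rev o' ho'), IsSymmetryCenter,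
    (Equiv.pointReflection_involutive o').image_eq_iff] at hs'
  -- The composite of the two point reflections is the translation by `2 (o' - o)`. Its iterates put
  -- infinitely many points of each such line on `S`, so `F` vanishes on the whole line.
  refine ⟨(2 : ℝ) • (o' - o), smul_ne_zero two_ne_zero (sub_ne_zero.mpr hne.symm), ?_⟩
  have hnat : ∀ n : ℕ, ∀ p ∈ S, p + (n : ℝ) • (2 : ℝ) • (o' - o) ∈ S := by
    intro n
    induction n with
    | zero => intro p hp; simpa using hp
    | succ n ih =>
      intro p hp
      have := hs' _ (hs _ (ih p hp))
      have e : Equiv.pointReflection o' (Equiv.pointReflection o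
          (p + (n : ℝ) • (2 : ℝ) • (o' - o))) = p + ((n + 1 : ℕ) : ℝ) • (2 : ℝ) • (o' - o) := by
        simp only [Equiv.pointReflection_apply, vsub_eq_sub, vadd_eq_add, Nat.cast_add,
          Nat.cast_one]
        module
      rwa [e] at this
  intro p hp t
  rw [h.equation.mem_iff]
  refine eval_eq_zero_of_infinite F p _ ?_ t
  exact Set.infinite_of_injective_forall_mem (f := fun n : ℕ => (n : ℝ)) Nat.cast_injective
    fun n => (h.equation.mem_iff _).mp (hnat n p hp)

end IsRevolutionSurface

/-! ### Assembly of the claims. -/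

theorem mainTheorem12
    (S : Set E3) (hS : IsIrreducibleAlgebraicSurface S) (hSplane : ¬ IsPlaneSet S)
    (ℓ : AffineSubspace ℝ E3) (hℓ : IsAxisOfRevolution ℓ S)
    (P : AffineSubspace ℝ E3) (hP : IsPlane P) (hℓP : ℓ ≤ P) :
    -- central symmetry
    ((∃ c : E3, IsSymmetryCenter c S) ↔ ∃ c ∈ ℓ, IsSymmetryCenter c (directrix S P)) ∧
    (¬ IsSphereSet S →
      -- symmetry axes other than the axis of revolution
      (∀ m : AffineSubspace ℝ E3, IsLine m → m ≠ ℓ →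
        (IsSymmetryAxis m S ↔
          ∃ (m₀ : AffineSubspace ℝ E3) (g : E3 ≃ᵃⁱ[ℝ] E3),
            IsPlanarSymmetryAxis P m₀ (directrix S P) ∧ IsNormalTo m₀ ℓ ∧
              IsRotationAbout ℓ g ∧ m = m₀.map (g.toAffineEquiv : E3 →ᵃ[ℝ] E3))) ∧
      -- symmetry planes not containing the axis of revolution
      (∀ Q : AffineSubspace ℝ E3, IsPlane Q → ¬ ℓ ≤ Q →
        (IsSymmetryPlane Q S ↔
          IsNormalTo Q ℓ ∧ IsPlanarSymmetryAxis P (Q ⊓ P) (directrix S P))) ∧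
      -- the case without planar symmetry axes normal to the axis of revolution
      ((¬ ∃ m₀ : AffineSubspace ℝ E3,
          IsPlanarSymmetryAxis P m₀ (directrix S P) ∧ IsNormalTo m₀ ℓ) →
        {m : AffineSubspace ℝ E3 | IsSymmetryAxis m S} = {ℓ} ∧
        {Q : AffineSubspace ℝ E3 | IsSymmetryPlane Q S} =
          {Q : AffineSubspace ℝ E3 | IsPlane Q ∧ ℓ ≤ Q}) ∧
      -- one or infinitely many symmetry axes
      ({m : AffineSubspace ℝ E3 | IsSymmetryAxis m S} = {ℓ} ∨
        {m : AffineSubspace ℝ E3 | IsSymmetryAxis m S}.Infinite) ∧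
      -- symmetry axes and symmetry planes
      ({m : AffineSubspace ℝ E3 | IsSymmetryAxis m S}.Infinite ↔
        ∃ Q : AffineSubspace ℝ E3, IsSymmetryPlane Q S ∧ ¬ ℓ ≤ Q) ∧
      {m : AffineSubspace ℝ E3 | IsSymmetryAxis m S} =
        {ℓ} ∪ {m : AffineSubspace ℝ E3 | ∃ R Q : AffineSubspace ℝ E3,
          IsPlane R ∧ ℓ ≤ R ∧ IsSymmetryPlane Q S ∧ ¬ ℓ ≤ Q ∧ m = R ⊓ Q} ∧
      -- the non-cylindrical case
      ({m : AffineSubspace ℝ E3 | IsSymmetryAxis m S}.Infinite → ¬ IsCylindrical S →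
        ∃ Q : AffineSubspace ℝ E3, IsSymmetryPlane Q S ∧
          ∀ m : AffineSubspace ℝ E3, IsSymmetryAxis m S → m ≠ ℓ → m ≤ Q)) := by
  obtain ⟨F, hirr, hSF, hdvd⟩ := hS
  obtain ⟨u, hu, hdir⟩ := hℓ.1.exists_direction
  have h : IsRevolutionSurface F S ℓ u :=
    { equation := ⟨hirr, fun p => by rw [hSF]; rfl, hdvd⟩
      not_plane := hSplane
      isLine := hℓ.1
      norm_eq := hu
      direction_eq := hdir
      rev := fun o ho => hℓ.revInvariant ho hdir }
  have huP : u ∈ P.direction := AffineSubspace.direction_le hℓP h.dir_mem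
  refine ⟨⟨?_, ?_⟩, fun hsph => ?_⟩
  · rintro ⟨c, hc⟩
    have hcℓ := h.mem_of_isSymmetryCenter hc
    exact ⟨c, hcℓ, (isSymmetryCenter_directrix_iff_revSymmetric hP hu (hℓP hcℓ) huP
      (h.rev c hcℓ)).mpr ((isSymmetryCenter_iff_revSymmetric (h.rev c hcℓ)).mp hc)⟩
  · rintro ⟨c, hcℓ, hc⟩
    exact ⟨c, (isSymmetryCenter_iff_revSymmetric (h.rev c hcℓ)).mpr
      ((isSymmetryCenter_directrix_iff_revSymmetric hP hu (hℓP hcℓ) huP (h.rev c hcℓ)).mp hc)⟩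
  -- Each kind of symmetry is traded for a point `o` of `ℓ` with `RevSymmetric o u S`, through which
  -- all the claims are compared.
  have hplanar : ∀ m₀, IsPlanarSymmetryAxis P m₀ (directrix S P) → IsNormalTo m₀ ℓ →
      ∃ o ∈ ℓ, o ∈ m₀ ∧ u ∈ m₀.directionᗮ ∧ RevSymmetric o u S := by
    intro m₀ hm₀ hn
    have hu₀ := (h.isNormalTo_iff m₀).mp hn
    obtain ⟨o, ho, hom⟩ := h.exists_mem_of_normal_line hP hℓP hm₀.1 hm₀.2.1 hu₀
    exact ⟨o, ho, hom, hu₀,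
      (h.isPlanarSymmetryAxis_iff hP hℓP hm₀.1 hm₀.2.1 ho hom hu₀).mp hm₀⟩
  have hplane : ∀ Q, IsSymmetryPlane Q S → ¬ ℓ ≤ Q →
      ∃ o ∈ ℓ, o ∈ Q ∧ u ∈ Q.directionᗮ ∧ RevSymmetric o u S :=
    fun Q hQ hne => (h.isSymmetryPlane_iff hsph hQ.1 hne).mp hQ
  have haxis : ∀ m, IsSymmetryAxis m S → m ≠ ℓ →
      ∃ o ∈ ℓ, o ∈ m ∧ u ∈ m.directionᗮ ∧ RevSymmetric o u S :=
    fun m hm hne => (h.isSymmetryAxis_iff hsph hm.1 hne).mp hm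
  have hnormal : ∀ o ∈ ℓ, RevSymmetric o u S →
      IsSymmetryPlane (AffineSubspace.mk' o (Submodule.span ℝ {u})ᗮ) S ∧
        ¬ ℓ ≤ AffineSubspace.mk' o (Submodule.span ℝ {u})ᗮ := by
    intro o ho hs
    obtain ⟨hQ, hoQ, huQ⟩ := h.normalPlane_spec o
    have hne := h.not_le_of_orthogonal huQ
    exact ⟨(h.isSymmetryPlane_iff hsph hQ hne).mpr ⟨o, ho, hoQ, huQ, hs⟩, hne⟩
  have hinf : {m : AffineSubspace ℝ E3 | IsSymmetryAxis m S}.Infinite →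
      ∃ m, IsSymmetryAxis m S ∧ m ≠ ℓ := by
    intro hi
    obtain ⟨m, hm, hne⟩ := hi.exists_notMem_finite (Set.finite_singleton ℓ)
    exact ⟨m, hm, hne⟩
  refine ⟨?_, ?_, ?_, ?_, ?_, ?_, ?_⟩
  · intro m hm hne
    rw [h.isSymmetryAxis_iff hsph hm hne]
    constructor
    · rintro ⟨o, ho, hom, hum, hs⟩
      obtain ⟨m₀, hm₀, hu₀, ho₀⟩ := h.exists_planarSymmetryAxis hP hℓP ho hs
      obtain ⟨g, hg, hmg⟩ := h.exists_rotation_map_line hm₀.1 hm ho ho₀ hom hu₀ hum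
      exact ⟨m₀, g, hm₀, (h.isNormalTo_iff m₀).mpr hu₀, hg, hmg⟩
    · rintro ⟨m₀, g, hm₀, hn, hg, rfl⟩
      obtain ⟨o, ho, hom, hu₀, hs⟩ := hplanar m₀ hm₀ hn
      refine ⟨o, ho, ⟨o, hom, hg.1 o ho⟩, ?_, hs⟩
      have hgu : g.linearIsometryEquiv u = u := by
        have := g.map_vsub (o + (1 : ℝ) • u) o
        rw [hg.1 _ (h.add_smul_mem ho 1), hg.1 o ho] at this
        simpa using this
      rw [AffineSubspace.map_direction, Submodule.mem_orthogonal]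
      rintro _ ⟨x, hx, rfl⟩
      change inner ℝ (g.linearIsometryEquiv x) u = 0
      rw [← hgu, LinearIsometryEquiv.inner_map_map]
      exact (Submodule.mem_orthogonal _ _).mp hu₀ x hx
  · intro Q hQ hne
    rw [h.isSymmetryPlane_iff hsph hQ hne, inf_comm, h.isNormalTo_iff]
    constructor
    · rintro ⟨o, ho, hoQ, huQ, hs⟩
      exact ⟨huQ, (h.isPlanarSymmetryAxis_iff hP hℓP (h.isLine_inf hP hℓP hQ huQ) inf_le_left ho
        ⟨hℓP ho, hoQ⟩ (IsRevolutionSurface.orthogonal_inf _ _ (hℓP ho) hoQ huQ)).mpr hs⟩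
    · rintro ⟨huQ, hs⟩
      obtain ⟨o, ho, hoQ⟩ := h.exists_mem_of_normal_plane hQ huQ
      exact ⟨o, ho, hoQ, huQ, (h.isPlanarSymmetryAxis_iff hP hℓP hs.1 hs.2.1 ho
        ⟨hℓP ho, hoQ⟩ (IsRevolutionSurface.orthogonal_inf _ _ (hℓP ho) hoQ huQ)).mp hs⟩
  · intro hno
    have hno' : ∀ o ∈ ℓ, ¬ RevSymmetric o u S := by
      intro o ho hs
      obtain ⟨m₀, hm₀, hu₀, -⟩ := h.exists_planarSymmetryAxis hP hℓP ho hs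
      exact hno ⟨m₀, hm₀, (h.isNormalTo_iff m₀).mpr hu₀⟩
    constructor
    · ext m
      refine ⟨fun hm => ?_, fun hm => ?_⟩
      · by_contra hne
        obtain ⟨o, ho, -, -, hs⟩ := haxis m hm hne
        exact hno' o ho hs
      · rw [Set.mem_singleton_iff.mp hm]
        exact h.isSymmetryAxis_self
    · ext Q
      refine ⟨fun hQ => ⟨hQ.1, ?_⟩, fun hQ => h.isSymmetryPlane_of_le hQ.1 hQ.2⟩
      by_contra hne
      obtain ⟨o, ho, -, -, hs⟩ := hplane Q hQ hne
      exact hno' o ho hs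
  · by_cases hex : ∃ m, IsSymmetryAxis m S ∧ m ≠ ℓ
    · obtain ⟨m, hm, hne⟩ := hex
      obtain ⟨o, ho, -, -, hs⟩ := haxis m hm hne
      exact Or.inr (h.infinite_symmetryAxes ho hs)
    · push Not at hex
      exact Or.inl (Set.eq_singleton_iff_unique_mem.mpr ⟨h.isSymmetryAxis_self, hex⟩)
  · constructor
    · intro hi
      obtain ⟨m, hm, hne⟩ := hinf hi
      obtain ⟨o, ho, -, -, hs⟩ := haxis m hm hne
      exact ⟨_, hnormal o ho hs⟩
    · rintro ⟨Q, hQ, hne⟩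
      obtain ⟨o, ho, -, -, hs⟩ := hplane Q hQ hne
      exact h.infinite_symmetryAxes ho hs
  · ext m
    constructor
    · intro hm
      by_cases hne : m = ℓ
      · exact Or.inl hne
      right
      obtain ⟨o, ho, hom, hum, hs⟩ := haxis m hm hne
      obtain ⟨R, hR, hℓR, hmR⟩ := h.exists_plane hm.1 ho hom
      obtain ⟨hQ, hneQ⟩ := hnormal o ho hs
      exact ⟨R, _, hR, hℓR, hQ, hneQ, hm.1.eq_of_le
        (h.isLine_inf hR hℓR hQ.1 (h.normalPlane_spec o).2.2)
        (le_inf hmR (IsRevolutionSurface.le_normalPlane hom hum))⟩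
    · rintro (rfl | ⟨R, Q, hR, hℓR, hQ, hne, rfl⟩)
      · exact h.isSymmetryAxis_self
      · obtain ⟨o, ho, hoQ, huQ, hs⟩ := hplane Q hQ hne
        have hu' := IsRevolutionSurface.orthogonal_inf Q R (hℓR ho) hoQ huQ
        exact (h.isSymmetryAxis_iff hsph (h.isLine_inf hR hℓR hQ.1 huQ)
          (h.ne_of_orthogonal hu')).mpr ⟨o, ho, ⟨hℓR ho, hoQ⟩, hu', hs⟩
  · intro hi hcyl
    obtain ⟨m, hm, hne⟩ := hinf hi
    obtain ⟨o, ho, hom, hum, hs⟩ := haxis m hm hne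
    refine ⟨_, (hnormal o ho hs).1, fun m' hm' hne' => ?_⟩
    obtain ⟨o', ho', hom', hum', hs'⟩ := haxis m' hm' hne'
    -- Away from cylinders the point `o` is unique, so every other axis lies in the plane normal to
    -- `ℓ` at `o`.
    have hoo : o = o' := by
      by_contra hoo
      exact hcyl (h.isCylindrical_of_ne ho ho' hs hs' hoo)
    subst hoo
    exact IsRevolutionSurface.le_normalPlane hom' hum'
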